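/- Let $M$ be a smooth $4$-manifold with a smooth Riemannian metric $g$, and let $\Sigma^1,\Sigma^2,\Sigma^3$ be smooth $2$-forms on $M$, $\Sigma^i=\tfrac12\Sigma^i_{\mu\nu}dx^\mu\wedge dx^\nu$, that satisfy (indices being raised with $g$) the quaternion algebra $$\Sigma^i_\mu{}^\alpha\,\Sigma^j_\alpha{}^\nu=-\delta^{ij}\delta_\mu^\nu+\epsilon^{ijk}\Sigma^k_\mu{}^\nu .$$ Thus the $\Sigma^i$ are an $SU(2)$ structure with metric $g$ and form a basis of the bundle of self-dual $2$-forms (for the orientation they determine), with $\Sigma^i_{\mu\nu}\Sigma^{j\,\mu\nu}=4\delta^{ij}$. Assume that $g$ is Einstein, $\mathrm{Ric}=\Lambda g$ with $\Lambda\in\mathbb R$ constant. Let $\Psi^{ij}=\tfrac18 W_{\mu\nu\rho\sigma}\Sigma^{i\,\mu\nu}\Sigma^{j\,\rho\sigma}$, with $W$ the Weyl tensor of $g$; this is the matrix in the basis $\Sigma^i$ of the self-dual Weyl tensor, regarded as the endomorphism $B_{\mu\nu}\mapsto\tfrac12W_{\mu\nu}{}^{\rho\sigma}B_{\rho\sigma}$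 of the self-dual $2$-forms. (Curvature signs are such that $\mathrm{Ric}$ and $R_{\mu\nu\mu\nu}$, $\mu\neq\nu$, are positive in orthonormal frames on round spheres.) Assume that the self-dual Weyl tensor is of type D and that the frame is adapted to it, that is, $$\Psi=\mathrm{diag}(2\alpha,-\alpha,-\alpha)$$ for a function $\alpha:M\to\mathbb R$ that vanishes nowhere (either sign is allowed; $\alpha^{-1/3}$ is the inverse of the real cube root). Then the vector field $$X^\mu=\Sigma^{1\,\mu\nu}\nabla_\nu\,\alpha^{-1/3}$$ is a Killing vector field: it is smooth and $\mathcal L_Xg=0$. Moreover $X$ is $\Sigma$-Killing, with an explicit parameter: if $A^1,A^2,A^3$ are $1$-forms with $d\Sigma^i+\epsilon^{ijk}A^j\wedge\Sigma^k=0$, then $$d(\iota_X\Sigma^i)+\epsilon^{ijk}A^j\wedge\iota_X\Sigma^k=\epsilon^{ijk}\theta^j\Sigma^k,\qquad \theta^1=\alpha^{-1/3}\Bigl(\alpha-\frac{\Lambda}{3}\Bigr),\quad \theta^2=\theta^3=0 .$$ -/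

import Mathlib

open Bundle
open scoped Manifold ContDiff

noncomputable section

namespace SelfDualGeometry

/-! ### Tensor calculus in coordinates on `ℝ⁴`

Tensor fields on (an open subset of) `ℝ⁴` are given by their components, indexed by `Fin 4`. -/

/-- The coordinate space `ℝ⁴`. -/
abbrev R4 : Type := EuclideanSpace ℝ (Fin 4)

/-- The partial derivative `∂_μ f` at `y`. -/
def pd (μ : Fin 4) (f : R4 → ℝ) (y : R4) : ℝ :=
  fderiv ℝ f y (EuclideanSpace.single μ 1)

/-- The totally antisymmetric symbol `ε^{ijk}`, with `ε^{012} = 1` (indices count from `0`). -/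
def eps (i j k : Fin 3) : ℝ :=
  (((j : ℕ) : ℝ) - ((i : ℕ) : ℝ)) * (((k : ℕ) : ℝ) - ((i : ℕ) : ℝ)) *
    (((k : ℕ) : ℝ) - ((j : ℕ) : ℝ)) / 2

/-- The Christoffel symbol `Γ^r_{m n}` of the metric `G`. -/
def christoffel (G : R4 → Matrix (Fin 4) (Fin 4) ℝ) (r m n : Fin 4) (y : R4) : ℝ :=
  (1 / 2) * ∑ k, (G y)⁻¹ r k *
    (pd m (fun z => G z k n) y + pd n (fun z => G z k m) y - pd k (fun z => G z m n) y)

/-- The Riemann tensor `R^r_{s m n}`, i.e.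
`R(∂_m, ∂_n) ∂_s = (∇_m ∇_n - ∇_n ∇_m) ∂_s = R^r_{s m n} ∂_r`. -/
def riemann (G : R4 → Matrix (Fin 4) (Fin 4) ℝ) (r s m n : Fin 4) (y : R4) : ℝ :=
  pd m (christoffel G r n s) y - pd n (christoffel G r m s) y
    + ∑ l, (christoffel G r m l y * christoffel G l n s y
      - christoffel G r n l y * christoffel G l m s y)

/-- The Riemann tensor with all indices lowered, `R_{r s m n} = g_{r l} R^l_{s m n}`. -/
def riemannLow (G : R4 → Matrix (Fin 4) (Fin 4) ℝ) (r s m n : Fin 4) (y : R4) : ℝ :=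
  ∑ l, G y r l * riemann G l s m n y

/-- The Ricci tensor `R_{s n} = R^r_{s r n}` (positive on round spheres). -/
def ricci (G : R4 → Matrix (Fin 4) (Fin 4) ℝ) (s n : Fin 4) (y : R4) : ℝ :=
  ∑ r, riemann G r s r n y

/-- The scalar curvature. -/
def scalarCurv (G : R4 → Matrix (Fin 4) (Fin 4) ℝ) (y : R4) : ℝ :=
  ∑ s, ∑ n, (G y)⁻¹ s n * ricci G s n y

/-- The Weyl tensor `W_{a b c d}` in dimension four. -/
def weyl (G : R4 → Matrix (Fin 4) (Fin 4) ℝ) (a b c d : Fin 4) (y : R4) : ℝ :=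
  riemannLow G a b c d y
    - (1 / 2) * (G y a c * ricci G b d y - G y a d * ricci G b c y
        - G y b c * ricci G a d y + G y b d * ricci G a c y)
    + scalarCurv G y / 6 * (G y a c * G y b d - G y a d * G y b c)

/-- A `2`-tensor with both indices raised, `B^{μ ν} = g^{μ a} B_{a b} g^{b ν}`. -/
def raised (G B : R4 → Matrix (Fin 4) (Fin 4) ℝ) (y : R4) : Matrix (Fin 4) (Fin 4) ℝ :=
  (G y)⁻¹ * B y * (G y)⁻¹

/-- The matrix `Ψ^{ij} = (1/8) W_{μνρσ} Σ^{i μν} Σ^{j ρσ}`.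
When `Σ^i_{μν} Σ^{j μν} = 4 δ^{ij}`, it is the matrix in the basis `Σ^i` of the self-dual Weyl
curvature, regarded as the endomorphism `B_{μν} ↦ (1/2) W_{μν}{}^{ρσ} B_{ρσ}` of the bundle
spanned by the `Σ^i`. -/
def selfDualWeylMatrix (G : R4 → Matrix (Fin 4) (Fin 4) ℝ)
    (S : Fin 3 → R4 → Matrix (Fin 4) (Fin 4) ℝ) (y : R4) : Matrix (Fin 3) (Fin 3) ℝ :=
  Matrix.of fun i j => (1 / 8) * ∑ m, ∑ n, ∑ r, ∑ s,
    weyl G m n r s y * raised G (S i) y m n * raised G (S j) y r s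

/-- The Lie derivative `(L_X g)_{μν} = X^k ∂_k g_{μν} + g_{kν} ∂_μ X^k + g_{μk} ∂_ν X^k`. -/
def lieDerivMetric (G : R4 → Matrix (Fin 4) (Fin 4) ℝ) (X : R4 → Fin 4 → ℝ)
    (μ ν : Fin 4) (y : R4) : ℝ :=
  ∑ k, (X y k * pd k (fun z => G z μ ν) y + G y k ν * pd μ (fun z => X z k) y
    + G y μ k * pd ν (fun z => X z k) y)

/-- The components
`(d^A B)^i_{μν} = ∂_μ B^i_ν - ∂_ν B^i_μ + ε^{ijk} (A^j_μ B^k_ν - A^j_ν B^k_μ)`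
of `d^A B^i = d B^i + ε^{ijk} A^j ∧ B^k`, for one-forms `B^i`. -/
def covExtDerivOne (A B : Fin 3 → R4 → Fin 4 → ℝ) (i : Fin 3) (μ ν : Fin 4) (y : R4) : ℝ :=
  pd μ (fun z => B i z ν) y - pd ν (fun z => B i z μ) y
    + ∑ j, ∑ k, eps i j k * (A j y μ * B k y ν - A j y ν * B k y μ)

/-- The components of the three-form `d^A B^i = d B^i + ε^{ijk} A^j ∧ B^k`, for two-forms
`B^i = (1/2) B^i_{μν} dx^μ ∧ dx^ν`. -/
def covExtDerivTwo (A : Fin 3 → R4 → Fin 4 → ℝ) (B : Fin 3 → R4 → Matrix (Fin 4) (Fin 4) ℝ)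
    (i : Fin 3) (μ ν ρ : Fin 4) (y : R4) : ℝ :=
  pd μ (fun z => B i z ν ρ) y + pd ν (fun z => B i z ρ μ) y + pd ρ (fun z => B i z μ ν) y
    + ∑ j, ∑ k, eps i j k * (A j y μ * B k y ν ρ + A j y ν * B k y ρ μ + A j y ρ * B k y μ ν)

/-- `a ↦ a^{-1/3}`, the inverse of the real cube root, for `a ≠ 0` of either sign. -/
def invCbrt (a : ℝ) : ℝ := SignType.sign a * |a| ^ (-(1 / 3) : ℝ)

/-! ### Tensor fields on a smooth four-manifold -/

section Manifold

variable {M : Type*} [TopologicalSpace M] [ChartedSpace R4 M]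

variable (M) in
/-- Vector fields on `M` (no regularity imposed). -/
abbrev VField : Type _ := (x : M) → TangentSpace (𝓡 4) x

variable (M) in
/-- One-forms on `M` (no regularity imposed). -/
abbrev OneForm : Type _ := (x : M) → (TangentSpace (𝓡 4) x →L[ℝ] ℝ)

variable (M) in
/-- Fields of bilinear forms on `M` (no regularity imposed). -/
abbrev BilinField : Type _ :=
  (x : M) → (TangentSpace (𝓡 4) x →L[ℝ] TangentSpace (𝓡 4) x →L[ℝ] ℝ)

variable (M) in
/-- Smooth Riemannian metrics on `M`. -/
abbrev SmoothMetric [IsManifold (𝓡 4) ∞ M] : Type _ :=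
  ContMDiffRiemannianMetric (𝓡 4) ∞ R4 (fun x : M => TangentSpace (𝓡 4) x)

/-- The coordinate vector field `∂_μ` of the chart `e`, at the point with coordinates `y`. -/
def coordVec (e : OpenPartialHomeomorph M R4) (y : R4) (μ : Fin 4) :
    TangentSpace (𝓡 4) (e.symm y) :=
  mfderiv (𝓡 4) (𝓡 4) e.symm y (EuclideanSpace.single μ 1 : R4)

/-- The components `T_{μν}` of a field of bilinear forms in the chart `e`. -/
def bilinComp (e : OpenPartialHomeomorph M R4) (T : BilinField M) (y : R4) :
    Matrix (Fin 4) (Fin 4) ℝ :=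
  Matrix.of fun μ ν => T (e.symm y) (coordVec e y μ) (coordVec e y ν)

/-- The components `A_μ` of a one-form in the chart `e`. -/
def formComp (e : OpenPartialHomeomorph M R4) (A : OneForm M) (y : R4) (μ : Fin 4) : ℝ :=
  A (e.symm y) (coordVec e y μ)

/-- The components `X^μ` of a vector field in the chart `e`. -/
def vecComp (e : OpenPartialHomeomorph M R4) (X : VField M) (y : R4) (μ : Fin 4) : ℝ :=
  (EuclideanSpace.proj μ : R4 →L[ℝ] ℝ) (mfderiv (𝓡 4) (𝓡 4) e (e.symm y) (X (e.symm y)))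

/-- The one-form `ι_X B = B(X, ·)`. -/
def contractWith (X : VField M) (B : BilinField M) : OneForm M := fun x => B x (X x)

/-- The differential `df` of a real function. -/
def differential (f : M → ℝ) : OneForm M := fun x => mfderiv (𝓡 4) 𝓘(ℝ, ℝ) f x

variable [IsManifold (𝓡 4) ∞ M]

/-- The scalar product of `g` on the tangent space at `x`, as an algebraic bilinear form. -/
def metricBilin (g : SmoothMetric M) (x : M) : LinearMap.BilinForm ℝ (TangentSpace (𝓡 4) x) :=
  LinearMap.mk₂ ℝ (fun v w => g.inner x v w) (by simp) (by simp) (by simp) (by simp)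

lemma metricBilin_nondegenerate (g : SmoothMetric M) (x : M) :
    (metricBilin g x).Nondegenerate := by
  constructor
  · intro v hv
    by_contra h
    exact absurd (hv v) (g.pos x v h).ne'
  · intro v hv
    by_contra h
    exact absurd (hv v) (g.pos x v h).ne'

instance (x : M) : FiniteDimensional ℝ (TangentSpace (𝓡 4) x) :=
  inferInstanceAs (FiniteDimensional ℝ R4)

/-- Raising the index of a covector `φ`: the vector `φ^♯` with `g(φ^♯, w) = φ(w)`. -/
def sharp (g : SmoothMetric M) (x : M) (φ : TangentSpace (𝓡 4) x →ₗ[ℝ] ℝ) :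
    TangentSpace (𝓡 4) x :=
  ((metricBilin g x).toDual (metricBilin_nondegenerate g x)).symm φ

lemma inner_sharp (g : SmoothMetric M) (x : M) (φ : TangentSpace (𝓡 4) x →ₗ[ℝ] ℝ)
    (w : TangentSpace (𝓡 4) x) : g.inner x (sharp g x φ) w = φ w :=
  LinearMap.BilinForm.apply_toDual_symm_apply (hB := metricBilin_nondegenerate g x)
    φ w

/-- The endomorphism `v^μ ↦ v^μ B_μ{}^ν` of the tangent space, i.e. `g(B^♯ v, w) = B(v, w)`. -/
def endo (g : SmoothMetric M) (B : BilinField M) (x : M) (v : TangentSpace (𝓡 4) x) :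
    TangentSpace (𝓡 4) x :=
  sharp g x (B x v).toLinearMap

/-- `Σ^1, Σ^2, Σ^3` (here indexed by `0, 1, 2`) is a triple of smooth two-forms that obeys the
quaternion algebra `Σ^i_μ{}^α Σ^j_α{}^ν = -δ^{ij} δ_μ^ν + ε^{ijk} Σ^k_μ{}^ν` with respect to `g`.
Such a triple is an `SU(2)` structure with metric `g`; it is an oriented orthogonal basis, with
`Σ^i_{μν} Σ^{j μν} = 4 δ^{ij}`, of the bundle of self-dual two-forms of `g` for the orientation
that it determines. -/
structure IsSU2Structure (g : SmoothMetric M) (S : Fin 3 → BilinField M) : Prop where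
  smooth : ∀ i, ContMDiff (𝓡 4) ((𝓡 4).prod 𝓘(ℝ, R4 →L[ℝ] R4 →L[ℝ] ℝ)) ∞
    (fun x : M => TotalSpace.mk' (R4 →L[ℝ] R4 →L[ℝ] ℝ)
      (E := fun x : M => TangentSpace (𝓡 4) x →L[ℝ] TangentSpace (𝓡 4) x →L[ℝ] ℝ) x (S i x))
  alternating : ∀ i x v, S i x v v = 0
  quaternion : ∀ i j x v, endo g (S j) x (endo g (S i) x v)
    = -((if i = j then (1 : ℝ) else 0) • v) + ∑ k, eps i j k • endo g (S k) x v

/-- The metric is Einstein with cosmological constant `Λ`: `Ric = Λ g`. -/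
def IsEinstein (g : SmoothMetric M) (Λ : ℝ) : Prop :=
  ∀ e ∈ atlas R4 M, ∀ y ∈ e.target, ∀ μ ν,
    ricci (bilinComp e g.inner) μ ν y = Λ * bilinComp e g.inner y μ ν

/-- In the frame `Σ^i`, the self-dual Weyl curvature is of type D with the special direction
`Σ^1`: `Ψ = diag(2α, -α, -α)` with `α` nowhere zero. -/
def IsTypeDFrame (g : SmoothMetric M) (S : Fin 3 → BilinField M) (α : M → ℝ) : Prop :=
  (∀ x, α x ≠ 0) ∧ ∀ e ∈ atlas R4 M, ∀ y ∈ e.target,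
    selfDualWeylMatrix (bilinComp e g.inner) (fun i => bilinComp e (S i)) y
      = Matrix.diagonal ![2 * α (e.symm y), -α (e.symm y), -α (e.symm y)]

/-- `X` is a Killing vector field of `g`: a smooth vector field with `L_X g = 0`. -/
def IsKilling (g : SmoothMetric M) (X : VField M) : Prop :=
  ContMDiff (𝓡 4) (𝓡 4).tangent ∞ (fun x : M => (⟨x, X x⟩ : TangentBundle (𝓡 4) M)) ∧
  ∀ e ∈ atlas R4 M, ∀ y ∈ e.target, ∀ μ ν,
    lieDerivMetric (bilinComp e g.inner) (vecComp e X) μ ν y = 0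

/-- `A` is the connection of the triple `Σ^i`: `d^A Σ^i = dΣ^i + ε^{ijk} A^j ∧ Σ^k = 0`. -/
def IsCompatibleConnection (S : Fin 3 → BilinField M) (A : Fin 3 → OneForm M) : Prop :=
  ∀ e ∈ atlas R4 M, ∀ y ∈ e.target, ∀ i μ ν ρ,
    covExtDerivTwo (fun j => formComp e (A j)) (fun k => bilinComp e (S k)) i μ ν ρ y = 0

/-- The `Σ`-Killing equation `d^A ι_X Σ^i = ε^{ijk} θ^j Σ^k`. -/
def SatisfiesSigmaKilling (S : Fin 3 → BilinField M) (A : Fin 3 → OneForm M) (X : VField M)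
    (θ : Fin 3 → M → ℝ) : Prop :=
  ∀ e ∈ atlas R4 M, ∀ y ∈ e.target, ∀ i μ ν,
    covExtDerivOne (fun j => formComp e (A j)) (fun k => formComp e (contractWith X (S k))) i μ ν y
      = ∑ j, ∑ k, eps i j k * θ j (e.symm y) * bilinComp e (S k) y μ ν

/-- The vector field `X^μ = B^{μν} ∇_ν f`: lowering its index gives `X_μ = B_{μν} (df^♯)^ν`,
i.e. `g(X, v) = B(v, df^♯)`. -/
def hamiltonianField (g : SmoothMetric M) (B : BilinField M) (f : M → ℝ) : VField M :=
  fun x => sharp g x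
    { toFun := fun v => B x v (sharp g x (differential f x).toLinearMap)
      map_add' := by simp
      map_smul' := by simp }

end Manifold

end SelfDualGeometry

end

open SelfDualGeometry

/-! Write `A, B, C` for the three two-forms in a chart and `I, J, K` for the endomorphisms `G⁻¹A,
G⁻¹B, G⁻¹C` (`acs`). The Levi-Civita derivative preserves the metric and the quaternion relations,
so it rotates the triple infinitesimally. This defines one-forms `a, b, c` (`connForm`) with `∇I =
-(bK - cJ)` and cyclically (`LocalTriple.covD_eq`). Antisymmetrizing gives `d^A Σ = 0`.

The curvature `da + b ∧ c` is a contraction of the Riemann tensor with `A`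
(`LocalTriple.curvForm_eq`). The trace of the commutator `[R, I]` brings in the Ricci tensor. For an
Einstein metric this forces the curvature into the span of the triple, and then `F^i = (Ψ^{ij} +
(Λ/3) δ^{ij}) Σ^j` (`LocalTriple.curvContract_eq_weyl`).

For `Ψ = diag(2α, -α, -α)`, the Bianchi identity `d^A F = 0` together with `d^A Σ = 0` gives `dα =
-3α cK = -3α bJ`, with one-forms as row vectors. The power `f = α^{-1/3}` is the one that absorbs
the factor 3: `df = f cK = f bJ`. Hence `ι_X A = df`, `ι_X B = f c` and `ι_X C = -f b`. Applying
`d^A`, the first component vanishes since `d(df) = 0`, and in the other two all terms combine to `f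
F^3` and `-f F^2`, which are multiples of `C` and `B`. This is the `Σ`-Killing equation with the
stated `θ`.

By Cartan's formula `L_X Σ^i` equals `d^A ι_X Σ^i` up to a rotation by `ι_X A`, so `X` preserves the
triple up to rotation. The metric is algebraically determined by the triple, hence `L_X g = 0`
(`LocalTriple.lieM_metric_eq_zero`). Finally the equations `d^A Σ = 0` have only one solution
(`LocalTriple.connection_unique_fst`), so any compatible connection is `(a, b, c)`. -/

namespace SelfDualGeometry

open Matrix

/-! ### Quaternionic triples of `4 × 4` matrices -/

/-- Real `4 × 4` matrices. -/
abbrev Mat4 : Type := Matrix (Fin 4) (Fin 4) ℝ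

/-- Matrices `I, J, K` with the multiplication table of the imaginary quaternions. -/
structure IsQuaternionTriple (I J K : Mat4) : Prop where
  II : I * I = -1
  JJ : J * J = -1
  KK : K * K = -1
  IJ : I * J = K
  JK : J * K = I
  KI : K * I = J
  JI : J * I = -K
  KJ : K * J = -I
  IK : I * K = -J

namespace IsQuaternionTriple

variable {I J K : Mat4}

/-- Cyclic symmetry: later results are proved for the first member only and transported to the
others by one or two rotations. -/
lemma rotate (h : IsQuaternionTriple I J K) : IsQuaternionTriple J K I :=
  ⟨h.JJ, h.KK, h.II, h.JK, h.KI, h.IJ, h.KJ, h.IK, h.JI⟩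

lemma left_mul {A B C : Mat4} (h : A * B = C) (P : Mat4) : A * (B * P) = C * P := by
  rw [← h, Matrix.mul_assoc]

lemma trace_fst (h : IsQuaternionTriple I J K) : I.trace = 0 := by
  have h1 : (J * K).trace = (K * J).trace := Matrix.trace_mul_comm J K
  rw [h.JK, h.KJ, Matrix.trace_neg] at h1
  linarith

end IsQuaternionTriple

/-- A quaternionic triple of matrices which are skew with respect to the positive definite
symmetric matrix `G`. -/
structure IsHermitianTriple (G I J K : Mat4) : Prop extends IsQuaternionTriple I J K where
  symm : Gᵀ = G
  pos : 0 < G 0 0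
  skewI : (G * I)ᵀ = -(G * I)
  skewJ : (G * J)ᵀ = -(G * J)
  skewK : (G * K)ᵀ = -(G * K)

namespace IsHermitianTriple

variable {G I J K : Mat4}

lemma rotate (h : IsHermitianTriple G I J K) : IsHermitianTriple G J K I :=
  { h.toIsQuaternionTriple.rotate with
    symm := h.symm, pos := h.pos, skewI := h.skewJ, skewJ := h.skewK, skewK := h.skewI }

end IsHermitianTriple

/-- The matrix with columns `v, I v, J v, K v`, where `v` is the first basis vector. -/
def quaternionFrame (I J K : Mat4) : Mat4 :=
  Matrix.of fun r c => ![(1 : Mat4) r 0, I r 0, J r 0, K r 0] c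

/-- Left multiplication by the quaternion `i`. -/
def stdI : Mat4 := !![0, -1, 0, 0; 1, 0, 0, 0; 0, 0, 0, -1; 0, 0, 1, 0]
/-- Left multiplication by the quaternion `j`. -/
def stdJ : Mat4 := !![0, 0, -1, 0; 0, 0, 0, 1; 1, 0, 0, 0; 0, -1, 0, 0]
/-- Left multiplication by the quaternion `k`. -/
def stdK : Mat4 := !![0, 0, 0, -1; 0, 0, -1, 0; 0, 1, 0, 0; 1, 0, 0, 0]

lemma mul_quaternionFrame {I J K : Mat4} (P : Mat4) :
    P * quaternionFrame I J K
      = Matrix.of fun r c => ![P r 0, (P * I) r 0, (P * J) r 0, (P * K) r 0] c := by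
  ext r c
  fin_cases c <;> simp [quaternionFrame, Matrix.mul_apply, Matrix.one_apply]

/-- In the frame `v, Iv, Jv, Kv` the multiplication table alone fixes the matrices, so every triple
is conjugate to the standard one once the frame is invertible. -/
lemma IsQuaternionTriple.mul_frame {I J K : Mat4} (h : IsQuaternionTriple I J K) :
    I * quaternionFrame I J K = quaternionFrame I J K * stdI ∧
    J * quaternionFrame I J K = quaternionFrame I J K * stdJ ∧
    K * quaternionFrame I J K = quaternionFrame I J K * stdK := by
  refine ⟨?_, ?_, ?_⟩ <;> rw [mul_quaternionFrame] <;> ext r c <;> fin_cases c <;>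
    simp [h.II, h.JJ, h.KK, h.IJ, h.JK, h.KI, h.JI, h.KJ, h.IK, quaternionFrame, stdI, stdJ, stdK,
      Matrix.mul_apply (M := Matrix.of _), Fin.sum_univ_four]

/-- Skewness moves a factor across the metric, so each Gram entry is the value at `(v, v)` of `G`
times a quaternion. The imaginary quaternions are skew and contribute zero; only the real part `G 0
0` survives. This makes the frame invertible. -/
lemma IsHermitianTriple.frame_orthogonal {G I J K : Mat4} (h : IsHermitianTriple G I J K) :
    (quaternionFrame I J K)ᵀ * G * quaternionFrame I J K = G 0 0 • 1 := by
  have key : ∀ P Q : Mat4, (G * P)ᵀ = -(G * P) → Pᵀ * (G * Q) = -(G * (P * Q)) := by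
    intro P Q hP
    rw [← Matrix.mul_assoc, ← Matrix.mul_assoc, ← Matrix.neg_mul, ← hP, Matrix.transpose_mul, h.symm]
  have z : ∀ P : Mat4, (G * P)ᵀ = -(G * P) → (G * P) 0 0 = 0 := by
    intro P hP
    have := congrFun (congrFun hP 0) 0
    simp only [Matrix.transpose_apply, Matrix.neg_apply] at this
    linarith
  have e : ∀ P Q : Mat4, ∑ r, P r 0 * (G * Q) r 0 = (Pᵀ * (G * Q)) 0 0 := fun P Q => by
    simp [Matrix.mul_apply]
  have hs := z I h.skewI
  have hJ := z J h.skewJ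
  have hK := z K h.skewK
  rw [Matrix.mul_assoc, mul_quaternionFrame]
  ext a b
  have hab : ((quaternionFrame I J K)ᵀ * Matrix.of fun r c =>
      ![G r 0, (G * I) r 0, (G * J) r 0, (G * K) r 0] c) a b
      = ((![1, I, J, K] a)ᵀ * (G * ![1, I, J, K] b)) 0 0 := by
    rw [← e]
    have h1 : ∀ r, quaternionFrame I J K r a = ![1, I, J, K] a r 0 := fun r => by
      fin_cases a <;> rfl
    have h2 : ∀ r, ![G r 0, (G * I) r 0, (G * J) r 0, (G * K) r 0] b
        = (G * ![1, I, J, K] b) r 0 := fun r => by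
      fin_cases b
      · exact congrFun (congrFun (Matrix.mul_one G).symm r) 0
      all_goals rfl
    rw [Matrix.mul_apply]
    simp only [Matrix.transpose_apply, Matrix.of_apply, h1, h2]
  refine hab.trans ?_
  have hIt := key I 1 h.skewI
  have hJt := key J 1 h.skewJ
  have hKt := key K 1 h.skewK
  simp only [Matrix.mul_one] at hIt hJt hKt
  fin_cases a <;> fin_cases b <;>
    simp [hIt, hJt, hKt, key _ _ h.skewI, key _ _ h.skewJ, key _ _ h.skewK, h.II, h.JJ, h.KK,
      h.IJ, h.JK, h.KI, h.JI, h.KJ, h.IK, hs, hJ, hK]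

/-- Under `so(4) = su(2) ⊕ su(2)` the left side is 0 on the commutant of the triple and 4 times the
identity on its span. For the standard matrices this is checked entrywise. -/
lemma stdTriple_sandwich {P : Mat4} (h : Pᵀ = -P) :
    (3 : ℝ) • P + stdI * P * stdI + stdJ * P * stdJ + stdK * P * stdK
      = -((P * stdI).trace • stdI + (P * stdJ).trace • stdJ + (P * stdK).trace • stdK) := by
  have hh : ∀ i j, P j i = - P i j := fun i j => congrFun (congrFun h i) j
  have h0 : ∀ i, P i i = 0 := fun i => by linarith [hh i i]
  have h10 := hh 0 1
  have h20 := hh 0 2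
  have h30 := hh 0 3
  have h21 := hh 1 2
  have h31 := hh 1 3
  have h32 := hh 2 3
  ext i j
  simp only [Matrix.add_apply, Matrix.neg_apply, Matrix.smul_apply, smul_eq_mul, Matrix.trace,
    Matrix.diag_apply, Matrix.mul_apply, Fin.sum_univ_four]
  fin_cases i <;> fin_cases j <;>
    simp only [Fin.mk_one, Fin.zero_eta, Fin.reduceFinMk, stdI, stdJ, stdK, Matrix.of_apply,
      Matrix.cons_val, h0, h10, h20, h30, h21, h31, h32] <;> ring

/-- The projection of a skew endomorphism to the span of a quaternionic triple. -/
theorem IsHermitianTriple.sandwich {G I J K P : Mat4} (h : IsHermitianTriple G I J K)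
    (hP : (G * P)ᵀ = -(G * P)) :
    (3 : ℝ) • P + I * P * I + J * P * J + K * P * K
      = -((P * I).trace • I + (P * J).trace • J + (P * K).trace • K) := by
  set E := quaternionFrame I J K with hE
  obtain ⟨hI, hJ, hK⟩ := h.toIsQuaternionTriple.mul_frame
  rw [← hE] at hI hJ hK
  have ho := h.frame_orthogonal
  rw [← hE] at ho
  set c := G 0 0 with hc
  have hc0 : c ≠ 0 := h.pos.ne'
  -- The inverse of the frame, read off from its orthogonality. With it `P` becomes `Q = F P E`,
  -- which is skew in the ordinary sense because it is a multiple of `Eᵀ (G P) E`.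
  set F : Mat4 := c⁻¹ • (Eᵀ * G) with hF
  have hFE : F * E = 1 := by
    rw [hF, Matrix.smul_mul, ho, smul_smul, inv_mul_cancel₀ hc0, one_smul]
  have hEF : E * F = 1 := _root_.mul_eq_one_comm.mp hFE
  set Q : Mat4 := F * P * E with hQ
  have hQs : Qᵀ = -Q := by
    have : Q = c⁻¹ • (Eᵀ * (G * P) * E) := by
      rw [hQ, hF]; simp [Matrix.mul_assoc]
    rw [this, Matrix.transpose_smul, Matrix.transpose_mul, Matrix.transpose_mul, hP]
    simp [Matrix.mul_assoc]
  have hPE : P * E = E * Q := by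
    rw [hQ, ← Matrix.mul_assoc, ← Matrix.mul_assoc, hEF, Matrix.one_mul]
  have tr : ∀ A s : Mat4, A * E = E * s → (P * A).trace = (Q * s).trace := by
    intro A s hA
    have h1 : P * A = E * (Q * s) * F := by
      rw [← Matrix.mul_assoc E, ← hPE, Matrix.mul_assoc P, ← hA, Matrix.mul_assoc, Matrix.mul_assoc,
        hEF, Matrix.mul_one]
    rw [h1, Matrix.trace_mul_comm, ← Matrix.mul_assoc, hFE, Matrix.one_mul]
  have sw : ∀ A s : Mat4, A * E = E * s → A * P * A * E = E * (s * Q * s) := by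
    intro A s hA
    rw [Matrix.mul_assoc, hA, ← Matrix.mul_assoc, Matrix.mul_assoc A, hPE, ← Matrix.mul_assoc, hA]
    simp only [Matrix.mul_assoc]
  have main : ((3 : ℝ) • P + I * P * I + J * P * J + K * P * K) * E
      = (-((P * I).trace • I + (P * J).trace • J + (P * K).trace • K)) * E := by
    rw [tr I _ hI, tr J _ hJ, tr K _ hK]
    simp only [Matrix.add_mul, Matrix.neg_mul, Matrix.smul_mul, sw I _ hI, sw J _ hJ, sw K _ hK, hPE,
      hI, hJ, hK]
    have := congrArg (fun Z => E * Z) (stdTriple_sandwich hQs)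
    simpa only [Matrix.mul_add, Matrix.mul_neg, Matrix.mul_smul] using this
  have := congrArg (fun Z => Z * F) main
  simpa only [Matrix.mul_assoc, hEF, Matrix.mul_one] using this

end SelfDualGeometry
-- Skew endomorphisms relative to a quaternionic triple
namespace SelfDualGeometry

open Matrix

variable {G I J K : Mat4}

lemma IsQuaternionTriple.trace_sq (h : IsQuaternionTriple I J K) : (I * I).trace = -4 := by
  rw [h.II, Matrix.trace_neg, Matrix.trace_one]; norm_num

lemma IsQuaternionTriple.trace_IJ (h : IsQuaternionTriple I J K) : (I * J).trace = 0 := by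
  rw [h.IJ]; exact h.rotate.rotate.trace_fst

lemma IsQuaternionTriple.trace_JI (h : IsQuaternionTriple I J K) : (J * I).trace = 0 := by
  rw [Matrix.trace_mul_comm]; exact h.trace_IJ

lemma trace_eq_zero_of_anticomm {P : Mat4} (hI : I * I = -1) (hP : P * I + I * P = 0) :
    P.trace = 0 := by
  have h1 : (I * P * I).trace = P.trace := by
    rw [Matrix.mul_assoc, eq_neg_of_add_eq_zero_left hP, Matrix.mul_neg, ← Matrix.mul_assoc, hI]
    simp
  rw [Matrix.trace_mul_comm, ← Matrix.mul_assoc, hI, Matrix.neg_mul, Matrix.one_mul,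
    Matrix.trace_neg] at h1
  linarith

lemma trace_mul_eq_zero_of_anticomm {P : Mat4} (hP : P * I + I * P = 0) : (P * I).trace = 0 := by
  have h := congrArg Matrix.trace hP
  rw [Matrix.trace_add, Matrix.trace_mul_comm I P, Matrix.trace_zero] at h
  linarith

/-- Anticommutation with `I` gives `IPI = P` and `KPK = -JPJ`, so the left side of `sandwich`
collapses to `4P`, and the trace against `I` drops out. -/
lemma IsHermitianTriple.anticomm_eq {P : Mat4} (h : IsHermitianTriple G I J K)
    (hs : (G * P)ᵀ = -(G * P)) (hP : P * I + I * P = 0) :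
    P = -(1 / 4 : ℝ) • ((P * J).trace • J + (P * K).trace • K) := by
  have h0 := h.sandwich hs
  rw [trace_mul_eq_zero_of_anticomm hP] at h0
  have e : P * I = -(I * P) := eq_neg_of_add_eq_zero_left hP
  have h1 : I * P * I = P := by
    rw [Matrix.mul_assoc, e, Matrix.mul_neg, ← Matrix.mul_assoc, h.II]; simp
  have h2 : K * P * K = -(J * P * J) := by
    have : I * J * P * (I * J) = -(J * P * J) := by
      have hIJ : I * J = -(J * I) := by rw [h.IJ, h.JI, neg_neg]
      calc I * J * P * (I * J) = -(J * (I * P) * (I * J)) := by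
            rw [hIJ]; simp only [Matrix.neg_mul, Matrix.mul_neg, Matrix.mul_assoc, neg_neg]
        _ = J * (P * (I * I) * J) := by
            rw [show I * P = -(P * I) by rw [e, neg_neg]]
            simp only [Matrix.neg_mul, Matrix.mul_neg, Matrix.mul_assoc, neg_neg]
        _ = -(J * P * J) := by
            rw [h.II]; simp only [Matrix.neg_mul, Matrix.mul_neg, Matrix.mul_one, Matrix.mul_assoc]
    rwa [h.IJ] at this
  rw [h1, h2] at h0
  have h3 : (4 : ℝ) • P = -((P * J).trace • J + (P * K).trace • K) := by
    rw [zero_smul, zero_add] at h0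
    rw [← h0]; module
  calc P = (1 / 4 : ℝ) • ((4 : ℝ) • P) := by module
    _ = _ := by rw [h3]; module

/-- A skew derivation of a quaternionic triple is an infinitesimal rotation. -/
theorem IsHermitianTriple.derivation_fst {P Q R : Mat4} (h : IsHermitianTriple G I J K)
    (hs : (G * P)ᵀ = -(G * P)) (hP : P * I + I * P = 0) (hQ : Q * J + J * Q = 0)
    (hKI : R * I + K * P = Q) :
    -- Here `P, Q, R` stand for the derivatives of `I, J, K`, and the hypotheses are the derivatives
    -- of `I² = -1`, `J² = -1` and `KI = J`. The trace of the last one turns the `K` coefficient of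
    -- `P` into a trace of `R` against `I`, which is the form used in `connForm`.
    P = -((-(1 / 4) * (R * I).trace) • K - (-(1 / 4) * (P * J).trace) • J) := by
  have h1 : (P * K).trace = -(R * I).trace := by
    have := congrArg Matrix.trace hKI
    rw [Matrix.trace_add, trace_eq_zero_of_anticomm h.JJ hQ, Matrix.trace_mul_comm K P] at this
    linarith
  have := h.anticomm_eq hs hP
  rw [h1] at this
  refine this.trans ?_
  module

/-- The sum of the commutant part of three skew endomorphisms cannot be in the quaternion algebra
unless it vanishes. -/
theorem IsHermitianTriple.commutant_eq_zero {N₁ N₂ N₃ : Mat4} {c u v w : ℝ}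
    (h : IsHermitianTriple G I J K) (hs : (G * N₁)ᵀ = -(G * N₁))
    (h1 : I * N₁ = N₁ * I) (h1' : J * N₁ = N₁ * J) (h2 : I * N₂ = N₂ * I) (h3 : I * N₃ = N₃ * I)
    (hsum : N₁ * I + N₂ * J + N₃ * K = c • (1 : Mat4) + u • I + v • J + w • K) : N₁ = 0 := by
  -- The map `Z ↦ IZI` reverses the sign of `N₁ I` and fixes `N₂ J` and `N₃ K`. Subtracting isolates
  -- `N₁ I`, which therefore lies in the span of `1` and `I`, and so does `N₁`.
  have hconj := congrArg (fun Z => I * Z * I) hsum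
  have a1 : I * (N₁ * I) * I = -(N₁ * I) := by
    rw [← Matrix.mul_assoc, h1, Matrix.mul_assoc, h.II]; simp
  have a2 : I * (N₂ * J) * I = N₂ * J := by
    rw [← Matrix.mul_assoc, h2, Matrix.mul_assoc, Matrix.mul_assoc, h.JI, Matrix.mul_neg, h.IK,
      neg_neg]
  have a3 : I * (N₃ * K) * I = N₃ * K := by
    rw [← Matrix.mul_assoc, h3, Matrix.mul_assoc, Matrix.mul_assoc, h.KI, h.IJ]
  simp only [Matrix.mul_add, Matrix.add_mul, a1, a2, a3, Matrix.mul_smul, Matrix.smul_mul, h.II,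
    h.IJ, h.IK, Matrix.mul_one, Matrix.neg_mul, h.KI, h.JI, Matrix.one_mul] at hconj
  have h4 : N₁ * I = c • (1 : Mat4) + u • I := by
    have : (2 : ℝ) • (N₁ * I) = (2 : ℝ) • (c • (1 : Mat4) + u • I) := by
      calc (2 : ℝ) • (N₁ * I)
          = (N₁ * I + N₂ * J + N₃ * K) - (-(N₁ * I) + N₂ * J + N₃ * K) := by module
        _ = _ := by rw [hsum, hconj]; module
    exact smul_right_injective _ two_ne_zero this
  have h5 : N₁ = u • (1 : Mat4) - c • I := by
    have := congrArg (fun Z => -(Z * I)) h4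
    simp only [Matrix.mul_assoc, Matrix.add_mul, Matrix.smul_mul, h.II, Matrix.mul_neg,
      Matrix.mul_one, Matrix.one_mul, neg_neg] at this
    rw [this]; module
  -- Commutation with `J` removes the `I` component; skewness, tested on the diagonal entry `G 0 0 >
  -- 0`, then removes the scalar one.
  have hc : c = 0 := by
    rw [h5] at h1'
    simp only [Matrix.mul_sub, Matrix.sub_mul, Matrix.mul_smul, Matrix.smul_mul, h.JI, h.IJ,
      Matrix.mul_one, Matrix.one_mul] at h1'
    have h6 : (2 * c) • K = 0 := by
      have : (2 * c) • K = (u • J - c • -K) - (u • J - c • K) := by module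
      rw [this, h1', sub_self]
    have h7 := congrArg (fun Z => (Z * K).trace) h6
    simp [h.rotate.rotate.trace_sq] at h7
    exact h7
  rw [hc, zero_smul, sub_zero] at h5
  rw [h5] at hs
  have h8 := congrFun (congrFun hs 0) 0
  simp at h8
  have hG := h.pos
  have hu : u = 0 := by
    have : u * G 0 0 = 0 := by linarith
    exact (mul_eq_zero.mp this).resolve_right hG.ne'
  rw [h5, hu, zero_smul]

/-- The component of `P` in the span of the triple. -/
noncomputable def tripleProj (I J K P : Mat4) : Mat4 :=
  -(1 / 4 : ℝ) • ((P * I).trace • I + (P * J).trace • J + (P * K).trace • K)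

lemma tripleProj_rotate (P : Mat4) : tripleProj J K I P = tripleProj I J K P := by
  unfold tripleProj; module

lemma IsHermitianTriple.sub_proj {P : Mat4} (h : IsHermitianTriple G I J K)
    (hP : (G * P)ᵀ = -(G * P)) :
    (4 : ℝ) • (P - tripleProj I J K P) = P - I * P * I - J * P * J - K * P * K := by
  have := h.sandwich hP
  have e : (4 : ℝ) • (P - tripleProj I J K P) = (4 : ℝ) • P -
      (-((P * I).trace • I + (P * J).trace • J + (P * K).trace • K)) := by
    unfold tripleProj; module
  rw [e, ← this]; module

/-- By `sub_proj` the complement of the projection is the average of `P` over conjugation by `1, I,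
J, K`, and such an average commutes with `I`. -/
lemma IsHermitianTriple.comm_sub_proj {P : Mat4} (h : IsHermitianTriple G I J K)
    (hP : (G * P)ᵀ = -(G * P)) :
    I * (P - tripleProj I J K P) = (P - tripleProj I J K P) * I := by
  have e : (4 : ℝ) • (I * (P - tripleProj I J K P)) = (4 : ℝ) • ((P - tripleProj I J K P) * I) := by
    rw [← Matrix.mul_smul, ← Matrix.smul_mul, h.sub_proj hP]
    simp only [Matrix.mul_sub, Matrix.sub_mul, Matrix.mul_assoc, h.II, h.JI, h.KI,
      IsQuaternionTriple.left_mul h.II, IsQuaternionTriple.left_mul h.IJ,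
      IsQuaternionTriple.left_mul h.IK, Matrix.mul_neg, Matrix.neg_mul, Matrix.mul_one,
      Matrix.one_mul]
    abel
  exact smul_right_injective _ four_ne_zero e

lemma IsHermitianTriple.skew_sub_proj {P : Mat4} (h : IsHermitianTriple G I J K)
    (hP : (G * P)ᵀ = -(G * P)) :
    (G * (P - tripleProj I J K P))ᵀ = -(G * (P - tripleProj I J K P)) := by
  unfold tripleProj
  simp only [Matrix.mul_sub, Matrix.transpose_sub, Matrix.mul_smul, Matrix.transpose_smul,
    Matrix.mul_add, Matrix.transpose_add, hP, h.skewI, h.skewJ, h.skewK]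
  module

/-- Subtracting the projections leaves commutant parts `Nᵢ` for which `N₁ I + N₂ J + N₃ K` is a
quaternion; `commutant_eq_zero` then gives `N₁ = 0`. It is applied to the curvature of an Einstein
metric. -/
lemma IsHermitianTriple.eq_tripleProj_fst {P₁ P₂ P₃ : Mat4} {L : ℝ}
    (h : IsHermitianTriple G I J K) (h1 : (G * P₁)ᵀ = -(G * P₁)) (h2 : (G * P₂)ᵀ = -(G * P₂))
    (h3 : (G * P₃)ᵀ = -(G * P₃)) (hsum : P₁ * I + P₂ * J + P₃ * K = L • (1 : Mat4)) :
    P₁ = tripleProj I J K P₁ := by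
  have hJ1 := h.rotate.comm_sub_proj h1
  rw [tripleProj_rotate] at hJ1
  refine sub_eq_zero.mp (h.commutant_eq_zero (h.skew_sub_proj h1) (h.comm_sub_proj h1) hJ1
    (h.comm_sub_proj h2) (h.comm_sub_proj h3)
    -- The four numbers are the coefficients of `1, I, J, K` in `L` minus the three projections
    -- multiplied by `I, J, K`.
    (c := L + (-(1 / 4) * ((P₁ * I).trace + (P₂ * J).trace + (P₃ * K).trace)))
    (u := (1 / 4) * ((P₂ * K).trace * (-1) + (P₃ * J).trace))
    (v := (1 / 4) * ((P₁ * K).trace - (P₃ * I).trace))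
    (w := (1 / 4) * (-(P₁ * J).trace + (P₂ * I).trace)) ?_)
  simp only [Matrix.sub_mul]
  have : P₁ * I - tripleProj I J K P₁ * I + (P₂ * J - tripleProj I J K P₂ * J)
      + (P₃ * K - tripleProj I J K P₃ * K) = L • (1 : Mat4) - tripleProj I J K P₁ * I
      - tripleProj I J K P₂ * J - tripleProj I J K P₃ * K := by rw [← hsum]; abel
  rw [this]
  simp only [tripleProj, Matrix.smul_mul, Matrix.add_mul, h.II, h.JJ, h.KK, h.IJ, h.JK, h.KI, h.JI,
    h.KJ, h.IK]
  module

/-! ### Contractions of `a ∧ B` -/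

/-- The components of `a ∧ B` for a one-form `a` and a two-form `B`. -/
def wedge (a : Fin 4 → ℝ) (B : Mat4) (μ ν ρ : Fin 4) : ℝ :=
  a μ * B ν ρ + a ν * B ρ μ + a ρ * B μ ν

/-- The term with the free index on `a` produces the trace; the other two coincide by antisymmetry.
When `B` and `S` come from the triple, `Q` is again a quaternion, so three-form equations become
equations for one-forms. -/
lemma contract_wedge (a : Fin 4 → ℝ) {S B Q : Mat4} (hS : Sᵀ = -S) (hB : Bᵀ = -B) (hQ : B * S = Q)
    (μ : Fin 4) :
    ∑ ν, ∑ ρ, B ν ρ * wedge a S μ ν ρ = -(Q.trace) * a μ + 2 * (a ᵥ* Q) μ := by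
  have hs : ∀ i j, S j i = -S i j := fun i j => congrFun (congrFun hS i) j
  have hb : ∀ i j, B j i = -B i j := fun i j => congrFun (congrFun hB i) j
  have e1 : ∑ ν, ∑ ρ, B ν ρ * (a μ * S ν ρ) = -(Q.trace) * a μ := by
    rw [← hQ, Matrix.trace]
    simp only [Matrix.diag_apply, Matrix.mul_apply, ← Finset.sum_neg_distrib, Finset.sum_mul]
    refine Finset.sum_congr rfl fun i _ => Finset.sum_congr rfl fun j _ => ?_
    rw [hs i j]; ring
  have e2 : ∑ ν, ∑ ρ, B ν ρ * (a ν * S ρ μ) = (a ᵥ* Q) μ := by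
    rw [← hQ]
    simp only [Matrix.vecMul, dotProduct, Matrix.mul_apply, Finset.mul_sum]
    refine Finset.sum_congr rfl fun i _ => Finset.sum_congr rfl fun j _ => ?_
    ring
  have e3 : ∑ ν, ∑ ρ, B ν ρ * (a ρ * S μ ν) = (a ᵥ* Q) μ := by
    rw [← e2, Finset.sum_comm]
    refine Finset.sum_congr rfl fun i _ => Finset.sum_congr rfl fun j _ => ?_
    rw [hb i j, hs j μ]; ring
  simp only [wedge, mul_add, Finset.sum_add_distrib, e1, e2, e3]
  ring

end SelfDualGeometry
namespace SelfDualGeometry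

open Matrix

/-! ### Partial derivatives of smooth functions and matrices on an open set -/

variable {U : Set R4} {y : R4} {f g : R4 → ℝ} {F H : R4 → Mat4}

lemma pd_congr (hU : IsOpen U) (hy : y ∈ U) (h : ∀ z ∈ U, f z = g z) (m : Fin 4) :
    pd m f y = pd m g y := by
  have : f =ᶠ[nhds y] g := Filter.eventuallyEq_of_mem (hU.mem_nhds hy) h
  rw [pd, pd, this.fderiv_eq]

lemma _root_.ContDiffOn.differentiableAt_of_open (hf : ContDiffOn ℝ ∞ f U) (hU : IsOpen U)
    (hy : y ∈ U) : DifferentiableAt ℝ f y :=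
  ((hf y hy).contDiffAt (hU.mem_nhds hy)).differentiableAt (by simp)

lemma contDiffOn_pd (hU : IsOpen U) (hf : ContDiffOn ℝ ∞ f U) (m : Fin 4) :
    ContDiffOn ℝ ∞ (pd m f) U :=
  (hf.fderiv_of_isOpen hU (by simp)).clm_apply contDiffOn_const

lemma pd_add (hU : IsOpen U) (hy : y ∈ U) (hf : ContDiffOn ℝ ∞ f U) (hg : ContDiffOn ℝ ∞ g U)
    (m : Fin 4) : pd m (fun z => f z + g z) y = pd m f y + pd m g y := by
  unfold pd
  rw [fderiv_fun_add (hf.differentiableAt_of_open hU hy) (hg.differentiableAt_of_open hU hy)]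
  rfl

lemma pd_neg (f : R4 → ℝ) (y : R4) (m : Fin 4) : pd m (fun z => -f z) y = -pd m f y := by
  unfold pd
  rw [fderiv_fun_neg]
  rfl

lemma pd_sub (hU : IsOpen U) (hy : y ∈ U) (hf : ContDiffOn ℝ ∞ f U) (hg : ContDiffOn ℝ ∞ g U)
    (m : Fin 4) : pd m (fun z => f z - g z) y = pd m f y - pd m g y := by
  unfold pd
  rw [fderiv_fun_sub (hf.differentiableAt_of_open hU hy) (hg.differentiableAt_of_open hU hy)]
  rfl

lemma pd_mul (hU : IsOpen U) (hy : y ∈ U) (hf : ContDiffOn ℝ ∞ f U) (hg : ContDiffOn ℝ ∞ g U)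
    (m : Fin 4) : pd m (fun z => f z * g z) y = pd m f y * g y + f y * pd m g y := by
  unfold pd
  rw [fderiv_fun_mul (hf.differentiableAt_of_open hU hy) (hg.differentiableAt_of_open hU hy)]
  simp only [_root_.add_apply, _root_.smul_apply, smul_eq_mul]
  ring

lemma pd_const (c : ℝ) (y : R4) (m : Fin 4) : pd m (fun _ => c) y = 0 := by
  simp [pd]

lemma pd_sum {ι : Type*} (s : Finset ι) {φ : ι → R4 → ℝ} (hU : IsOpen U) (hy : y ∈ U)
    (hf : ∀ i, ContDiffOn ℝ ∞ (φ i) U) (m : Fin 4) :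
    pd m (fun z => ∑ i ∈ s, φ i z) y = ∑ i ∈ s, pd m (φ i) y := by
  unfold pd
  rw [fderiv_fun_sum fun i _ => (hf i).differentiableAt_of_open hU hy]
  simp

lemma pd_comm (hU : IsOpen U) (hy : y ∈ U) (hf : ContDiffOn ℝ ∞ f U) (m n : Fin 4) :
    pd m (pd n f) y = pd n (pd m f) y := by
  have h1 : DifferentiableAt ℝ (fderiv ℝ f) y :=
    (((hf.fderiv_of_isOpen hU (m := ∞) (by simp)) y hy).contDiffAt
      (hU.mem_nhds hy)).differentiableAt (by simp)
  have h2 : ∀ k l : Fin 4, pd k (pd l f) y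
      = fderiv ℝ (fderiv ℝ f) y (EuclideanSpace.single k 1) (EuclideanSpace.single l 1) := by
    intro k l
    have : pd l f = fun z => fderiv ℝ f z (EuclideanSpace.single l 1) := rfl
    rw [this, pd, fderiv_clm_apply h1 (differentiableAt_const _)]
    simp
  rw [h2, h2]
  have hs := ((hf y hy).contDiffAt (hU.mem_nhds hy)).isSymmSndFDerivAt
    (by simpa using WithTop.coe_le_coe.mpr (le_top : (2 : ℕ∞) ≤ ⊤))
  exact hs _ _

/-- Smoothness of the entries of a matrix valued function. -/
def MSmooth (U : Set R4) (F : R4 → Mat4) : Prop := ∀ i j, ContDiffOn ℝ ∞ (fun y => F y i j) U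

/-- The entrywise partial derivative of a matrix valued function. -/
noncomputable def pdM (m : Fin 4) (F : R4 → Mat4) (y : R4) : Mat4 :=
  Matrix.of fun i j => pd m (fun z => F z i j) y

lemma pdM_apply (m : Fin 4) (F : R4 → Mat4) (y : R4) (i j : Fin 4) :
    pdM m F y i j = pd m (fun z => F z i j) y := rfl

namespace MSmooth

lemma add (hF : MSmooth U F) (hH : MSmooth U H) : MSmooth U (fun y => F y + H y) :=
  fun i j => (hF i j).add (hH i j)

lemma sub (hF : MSmooth U F) (hH : MSmooth U H) : MSmooth U (fun y => F y - H y) :=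
  fun i j => (hF i j).sub (hH i j)

lemma mul (hF : MSmooth U F) (hH : MSmooth U H) : MSmooth U (fun y => F y * H y) := by
  intro i j
  simp only [Matrix.mul_apply]
  exact ContDiffOn.sum fun k _ => (hF i k).mul (hH k j)

lemma smul (hf : ContDiffOn ℝ ∞ f U) (hF : MSmooth U F) : MSmooth U (fun y => f y • F y) :=
  fun i j => hf.mul (hF i j)

lemma transpose (hF : MSmooth U F) : MSmooth U (fun y => (F y)ᵀ) := fun i j => hF j i

lemma trace (hF : MSmooth U F) : ContDiffOn ℝ ∞ (fun y => (F y).trace) U := by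
  simp only [Matrix.trace, Matrix.diag_apply]
  exact ContDiffOn.sum fun k _ => hF k k

lemma pdM (hU : IsOpen U) (hF : MSmooth U F) (m : Fin 4) : MSmooth U (pdM m F) :=
  fun i j => contDiffOn_pd hU (hF i j) m

lemma det (hF : MSmooth U F) : ContDiffOn ℝ ∞ (fun y => (F y).det) U := by
  simp only [Matrix.det_apply]
  exact ContDiffOn.sum fun σ _ => (contDiffOn_prod fun i _ => hF (σ i) i).const_smul _

lemma inv (hF : MSmooth U F) (hd : ∀ y ∈ U, (F y).det ≠ 0) : MSmooth U (fun y => (F y)⁻¹) := by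
  intro i j
  simp only [Matrix.inv_def, Matrix.smul_apply, Ring.inverse_eq_inv', smul_eq_mul,
    Matrix.adjugate_apply]
  -- Cramer's rule: an entry of the adjugate is the determinant with one row replaced by a constant
  -- basis vector.
  refine (hF.det.inv hd).mul (det (F := fun y => (F y).updateRow j (Pi.single i 1)) ?_)
  intro k l
  by_cases hk : k = j
  · subst hk
    simpa using contDiffOn_const
  · simpa [Matrix.updateRow_apply, hk] using hF k l

end MSmooth

lemma pdM_congr (hU : IsOpen U) (hy : y ∈ U) (h : ∀ z ∈ U, F z = H z) (m : Fin 4) :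
    pdM m F y = pdM m H y := by
  ext i j
  exact pd_congr hU hy (fun z hz => by rw [h z hz]) m

lemma pdM_add (hU : IsOpen U) (hy : y ∈ U) (hF : MSmooth U F) (hH : MSmooth U H) (m : Fin 4) :
    pdM m (fun z => F z + H z) y = pdM m F y + pdM m H y := by
  ext i j
  exact pd_add hU hy (hF i j) (hH i j) m

lemma pdM_sub (hU : IsOpen U) (hy : y ∈ U) (hF : MSmooth U F) (hH : MSmooth U H) (m : Fin 4) :
    pdM m (fun z => F z - H z) y = pdM m F y - pdM m H y := by
  ext i j
  exact pd_sub hU hy (hF i j) (hH i j) m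

lemma pdM_neg (F : R4 → Mat4) (y : R4) (m : Fin 4) : pdM m (fun z => -F z) y = -pdM m F y := by
  ext i j
  exact pd_neg _ y m

lemma pdM_smul (hU : IsOpen U) (hy : y ∈ U) (hf : ContDiffOn ℝ ∞ f U) (hF : MSmooth U F)
    (m : Fin 4) : pdM m (fun z => f z • F z) y = pd m f y • F y + f y • pdM m F y := by
  ext i j
  exact pd_mul hU hy hf (hF i j) m

lemma pdM_mul (hU : IsOpen U) (hy : y ∈ U) (hF : MSmooth U F) (hH : MSmooth U H) (m : Fin 4) :
    pdM m (fun z => F z * H z) y = pdM m F y * H y + F y * pdM m H y := by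
  ext i j
  simp only [pdM_apply, Matrix.mul_apply, Matrix.add_apply]
  rw [pd_sum _ hU hy (fun k => (hF i k).mul (hH k j)), ← Finset.sum_add_distrib]
  exact Finset.sum_congr rfl fun k _ => pd_mul hU hy (hF i k) (hH k j) m

lemma pdM_const (C : Mat4) (y : R4) (m : Fin 4) : pdM m (fun _ => C) y = 0 := by
  ext i j
  exact pd_const _ y m

lemma pdM_transpose (F : R4 → Mat4) (y : R4) (m : Fin 4) :
    pdM m (fun z => (F z)ᵀ) y = (pdM m F y)ᵀ := rfl

lemma pdM_comm (hU : IsOpen U) (hy : y ∈ U) (hF : MSmooth U F) (m n : Fin 4) :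
    pdM m (pdM n F) y = pdM n (pdM m F) y := by
  ext i j
  exact pd_comm hU hy (hF i j) m n

/-! ### The Levi-Civita connection in coordinates -/

/-- The matrix `(Γ_n)^r_s = Γ^r_{n s}`. -/
noncomputable def gam (G : R4 → Mat4) (n : Fin 4) (y : R4) : Mat4 :=
  Matrix.of fun r s => christoffel G r n s y

/-- The curvature matrix `(R_{mn})^r_s = R^r_{s m n}`. -/
noncomputable def curvM (G : R4 → Mat4) (m n : Fin 4) (y : R4) : Mat4 :=
  pdM m (gam G n) y - pdM n (gam G m) y + (gam G m y * gam G n y - gam G n y * gam G m y)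

lemma curvM_apply (G : R4 → Mat4) (r s m n : Fin 4) (y : R4) :
    curvM G m n y r s = riemann G r s m n y := by
  simp only [curvM, riemann, Matrix.add_apply, Matrix.sub_apply, Matrix.mul_apply,
    ← Finset.sum_sub_distrib]
  rfl

lemma curvM_antisymm (G : R4 → Mat4) (y : R4) (m n : Fin 4) : curvM G m n y = -curvM G n m y := by
  unfold curvM; abel

lemma riemannLow_eq (G : R4 → Mat4) (y : R4) (r s m n : Fin 4) :
    riemannLow G r s m n y = (G y * curvM G m n y) r s := by
  simp only [riemannLow, Matrix.mul_apply, curvM_apply]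

lemma riemannLow_antisymm_right (G : R4 → Mat4) (y : R4) (r s m n : Fin 4) :
    riemannLow G r s m n y = -riemannLow G r s n m y := by
  rw [riemannLow_eq, riemannLow_eq, curvM_antisymm, Matrix.mul_neg, Matrix.neg_apply]

/-- A smooth metric on an open set of `ℝ⁴`, given by its components. -/
structure LocalMetric (U : Set R4) (G : R4 → Mat4) : Prop where
  isOpen : IsOpen U
  smooth : MSmooth U G
  symm : ∀ y ∈ U, (G y)ᵀ = G y
  det_ne : ∀ y ∈ U, (G y).det ≠ 0
  pos : ∀ y ∈ U, 0 < G y 0 0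

namespace LocalMetric

variable {G : R4 → Mat4} (h : LocalMetric U G)
include h

lemma inv_mul (hy : y ∈ U) : (G y)⁻¹ * G y = 1 :=
  Matrix.nonsing_inv_mul _ (isUnit_iff_ne_zero.mpr (h.det_ne y hy))

lemma mul_inv (hy : y ∈ U) : G y * (G y)⁻¹ = 1 :=
  Matrix.mul_nonsing_inv _ (isUnit_iff_ne_zero.mpr (h.det_ne y hy))

lemma smooth_inv : MSmooth U (fun y => (G y)⁻¹) := h.smooth.inv h.det_ne

lemma symm_apply (hy : y ∈ U) (i j : Fin 4) : G y i j = G y j i :=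
  congrFun (congrFun (h.symm y hy) j) i

lemma inv_symm (hy : y ∈ U) : ((G y)⁻¹)ᵀ = (G y)⁻¹ := by
  rw [Matrix.transpose_nonsing_inv, h.symm y hy]

lemma pd_symm (hy : y ∈ U) (m i j : Fin 4) :
    pd m (fun z => G z i j) y = pd m (fun z => G z j i) y :=
  pd_congr h.isOpen hy (fun _ hz => h.symm_apply hz i j) m

lemma smooth_gam (n : Fin 4) : MSmooth U (gam G n) := by
  intro r s
  refine ContDiffOn.mul contDiffOn_const (ContDiffOn.sum fun k _ => (h.smooth_inv r k).mul ?_)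
  exact ((contDiffOn_pd h.isOpen (h.smooth k s) n).add
    (contDiffOn_pd h.isOpen (h.smooth k n) s)).sub (contDiffOn_pd h.isOpen (h.smooth n s) k)

lemma christoffel_symm (hy : y ∈ U) (r m n : Fin 4) :
    christoffel G r m n y = christoffel G r n m y := by
  unfold christoffel
  congr 1
  refine Finset.sum_congr rfl fun k _ => ?_
  rw [h.pd_symm hy k m n]; ring

lemma mul_gam_apply (hy : y ∈ U) (n i j : Fin 4) :
    (G y * gam G n y) i j = (1 / 2) * (pd n (fun z => G z i j) y + pd j (fun z => G z i n) y
      - pd i (fun z => G z n j) y) := by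
  set v : Fin 4 → ℝ := fun k => (1 / 2) * (pd n (fun z => G z k j) y + pd j (fun z => G z k n) y
      - pd k (fun z => G z n j) y) with hv
  have e : ∀ r, gam G n y r j = ((G y)⁻¹ *ᵥ v) r := by
    intro r
    simp only [gam, Matrix.of_apply, christoffel, Matrix.mulVec, dotProduct, hv, Finset.mul_sum]
    refine Finset.sum_congr rfl fun k _ => ?_
    ring
  have : (G y * gam G n y) i j = (G y *ᵥ ((G y)⁻¹ *ᵥ v)) i := by
    simp only [Matrix.mul_apply, e]
    rfl
  rw [this, Matrix.mulVec_mulVec, h.mul_inv hy, Matrix.one_mulVec]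

/-- The Levi-Civita connection is metric. -/
lemma pdM_metric (hy : y ∈ U) (n : Fin 4) :
    pdM n G y = (gam G n y)ᵀ * G y + G y * gam G n y := by
  have e : (gam G n y)ᵀ * G y = (G y * gam G n y)ᵀ := by
    rw [Matrix.transpose_mul, h.symm y hy]
  rw [e]
  ext i j
  rw [Matrix.add_apply, Matrix.transpose_apply, h.mul_gam_apply hy, h.mul_gam_apply hy, pdM_apply,
    h.pd_symm hy n j i, h.pd_symm hy i n j, h.pd_symm hy j n i]
  ring

/-- The first Bianchi identity. -/
lemma bianchi (hy : y ∈ U) (r s m n : Fin 4) :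
    curvM G m n y r s + curvM G n s y r m + curvM G s m y r n = 0 := by
  have hg : ∀ i j r, gam G i y r j = gam G j y r i := fun i j r => h.christoffel_symm hy r i j
  have hp : ∀ k i j r, pdM k (gam G i) y r j = pdM k (gam G j) y r i := fun k i j r =>
    pd_congr h.isOpen hy (fun _ hz => h.christoffel_symm hz r i j) k
  have hm : ∀ k i j r, (gam G k y * gam G i y) r j = (gam G k y * gam G j y) r i := by
    intro k i j r
    simp only [Matrix.mul_apply, hg i j]
  simp only [curvM, Matrix.add_apply, Matrix.sub_apply]
  linarith [hp m n s r, hp n s m r, hp s m n r, hm m n s r, hm n s m r, hm s m n r]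

/-- The curvature is skew with respect to the metric. -/
lemma curvM_skew (hy : y ∈ U) (m n : Fin 4) :
    (G y * curvM G m n y)ᵀ = -(G y * curvM G m n y) := by
  have hU := h.isOpen
  have key : ∀ k l, pdM k (pdM l G) y
      = (pdM k (gam G l) y)ᵀ * G y + (gam G l y)ᵀ * ((gam G k y)ᵀ * G y + G y * gam G k y)
        + (((gam G k y)ᵀ * G y + G y * gam G k y) * gam G l y + G y * pdM k (gam G l) y) := by
    intro k l
    have hl := h.smooth_gam l
    rw [pdM_congr hU hy (fun _ hz => h.pdM_metric hz l) k,
      pdM_add hU hy (hl.transpose.mul h.smooth) (h.smooth.mul hl),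
      pdM_mul hU hy hl.transpose h.smooth, pdM_mul hU hy h.smooth hl, h.pdM_metric hy k,
      pdM_transpose]
  -- Second partial derivatives of the metric commute; expressed through the connection matrices,
  -- that identity is the skewness of the curvature.
  have h1 := key m n
  rw [pdM_comm hU hy h.smooth, key n m, ← sub_eq_zero] at h1
  rw [Matrix.transpose_mul, h.symm y hy, eq_neg_iff_add_eq_zero, ← neg_eq_zero, ← h1, curvM]
  simp only [Matrix.transpose_add, Matrix.transpose_sub, Matrix.transpose_mul, Matrix.mul_add,
    Matrix.add_mul, Matrix.mul_sub, Matrix.sub_mul, Matrix.mul_assoc]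
  abel

lemma riemannLow_antisymm_left (hy : y ∈ U) (r s m n : Fin 4) :
    riemannLow G r s m n y = -riemannLow G s r m n y := by
  rw [riemannLow_eq, riemannLow_eq]
  exact congrFun (congrFun (h.curvM_skew hy m n) s) r

lemma riemannLow_bianchi (hy : y ∈ U) (r s m n : Fin 4) :
    riemannLow G r s m n y + riemannLow G r m n s y + riemannLow G r n s m y = 0 := by
  simp only [riemannLow_eq, Matrix.mul_apply, ← Finset.sum_add_distrib, ← mul_add]
  exact Finset.sum_eq_zero fun l _ => by rw [h.bianchi hy, mul_zero]

/-- The classical octahedron argument: four cyclic identities combined with antisymmetry in each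
index pair. -/
lemma riemannLow_pair_symm (hy : y ∈ U) (r s m n : Fin 4) :
    riemannLow G r s m n y = riemannLow G m n r s y := by
  have b1 := h.riemannLow_bianchi hy r s m n
  have b2 := h.riemannLow_bianchi hy s m n r
  have b3 := h.riemannLow_bianchi hy m n r s
  have b4 := h.riemannLow_bianchi hy n r s m
  have a := fun a b c d => h.riemannLow_antisymm_left hy a b c d
  have c := fun a b c d => riemannLow_antisymm_right G y a b c d
  linarith [a r s m n, a r s n m, c r s m n, a m n r s, c m n r s, a m n s r, a r m n s, c r m n s,
    a r n s m, c r n s m, a s m n r, c s m n r, a s n r m, c s n r m, a m r s n, c m r s n,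
    a n s m r, c n s m r, c s r m n, c n m r s, a s r m n, a n m r s, c m s n r, c n r s m,
    c s n m r, c r n m s, c m r n s]

end LocalMetric

end SelfDualGeometry
-- The `SU(2)` connection of a triple and its curvature
namespace SelfDualGeometry

open Matrix

/-- The endomorphism `G⁻¹ A`. -/
noncomputable def acs (G A : R4 → Mat4) (y : R4) : Mat4 := (G y)⁻¹ * A y

/-- The Levi-Civita covariant derivative of an endomorphism. -/
noncomputable def covD (G P : R4 → Mat4) (m : Fin 4) (y : R4) : Mat4 :=
  pdM m P y + gam G m y * P y - P y * gam G m y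

/-- The component of the `SU(2)` connection obtained from two of the two-forms. -/
noncomputable def connForm (G B C : R4 → Mat4) (m : Fin 4) (y : R4) : ℝ :=
  -(1 / 4) * (covD G (acs G B) m y * acs G C y).trace

/-- The components of `da + b ∧ c`. -/
noncomputable def curvForm (a b c : Fin 4 → R4 → ℝ) (y : R4) : Mat4 :=
  Matrix.of fun m n => pd m (a n) y - pd n (a m) y + (b m y * c n y - b n y * c m y)

/-- An `SU(2)` structure `A, B, C` with metric `G` on an open set of `ℝ⁴`. -/
structure LocalTriple (U : Set R4) (G A B C : R4 → Mat4) : Prop extends LocalMetric U G where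
  smoothA : MSmooth U A
  smoothB : MSmooth U B
  smoothC : MSmooth U C
  skewA : ∀ y ∈ U, (A y)ᵀ = -A y
  skewB : ∀ y ∈ U, (B y)ᵀ = -B y
  skewC : ∀ y ∈ U, (C y)ᵀ = -C y
  quat : ∀ y ∈ U, IsQuaternionTriple (acs G A y) (acs G B y) (acs G C y)

variable {U : Set R4} {y : R4} {G A B C : R4 → Mat4}

namespace LocalMetric

variable (h : LocalMetric U G)
include h

lemma mul_acs (hy : y ∈ U) (A : R4 → Mat4) : G y * acs G A y = A y := by
  rw [acs, ← Matrix.mul_assoc, h.mul_inv hy, Matrix.one_mul]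

lemma smooth_acs (hA : MSmooth U A) : MSmooth U (acs G A) := h.smooth_inv.mul hA

lemma smooth_covD (hA : MSmooth U A) (m : Fin 4) : MSmooth U (covD G A m) :=
  ((hA.pdM h.isOpen m).add ((h.smooth_gam m).mul hA)).sub (hA.mul (h.smooth_gam m))

lemma smooth_connForm (hB : MSmooth U B) (hC : MSmooth U C) (m : Fin 4) :
    ContDiffOn ℝ ∞ (connForm G B C m) U :=
  contDiffOn_const.mul ((h.smooth_covD (h.smooth_acs hB) m).mul (h.smooth_acs hC)).trace

/-- Metric compatibility: lowering an index commutes with `∇`, so the lowered `∇(G⁻¹A)` is `∇A`. Its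
skewness is then inherited from `A`. -/
lemma mul_covD (hy : y ∈ U) (hA : MSmooth U A) (m : Fin 4) :
    G y * covD G (acs G A) m y
      = pdM m A y - (gam G m y)ᵀ * A y - A y * gam G m y := by
  have e : pdM m A y = pdM m G y * acs G A y + G y * pdM m (acs G A) y := by
    rw [← pdM_mul h.isOpen hy h.smooth (h.smooth_acs hA)]
    exact pdM_congr h.isOpen hy (fun z hz => (h.mul_acs hz A).symm) m
  have h1 := h.mul_acs hy A
  rw [e, h.pdM_metric hy, covD]
  simp only [Matrix.mul_add, Matrix.mul_sub, Matrix.add_mul, Matrix.mul_assoc, h1]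
  rw [← Matrix.mul_assoc (G y) (acs G A y), h1]
  abel

lemma covD_skew (hy : y ∈ U) (hA : MSmooth U A) (hs : ∀ y ∈ U, (A y)ᵀ = -A y) (m : Fin 4) :
    (G y * covD G (acs G A) m y)ᵀ = -(G y * covD G (acs G A) m y) := by
  have e : (pdM m A y)ᵀ = -pdM m A y := by
    rw [← pdM_transpose, ← pdM_neg]
    exact pdM_congr h.isOpen hy hs m
  rw [h.mul_covD hy hA]
  simp only [Matrix.transpose_sub, Matrix.transpose_mul, Matrix.transpose_transpose, e, hs y hy,
    Matrix.mul_neg, Matrix.neg_mul]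
  abel

lemma covD_mul (hy : y ∈ U) {P Q R : R4 → Mat4} (hP : MSmooth U P) (hQ : MSmooth U Q)
    (hR : ∀ z ∈ U, P z * Q z = R z) (m : Fin 4) :
    covD G P m y * Q y + P y * covD G Q m y = covD G R m y := by
  have e : pdM m R y = pdM m P y * Q y + P y * pdM m Q y := by
    rw [← pdM_mul h.isOpen hy hP hQ]
    exact pdM_congr h.isOpen hy (fun z hz => (hR z hz).symm) m
  unfold covD
  rw [e, ← hR y hy]
  simp only [Matrix.mul_add, Matrix.mul_sub, Matrix.add_mul, Matrix.sub_mul, Matrix.mul_assoc]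
  abel

lemma covD_sq (hy : y ∈ U) {P : R4 → Mat4} (hP : MSmooth U P)
    (hR : ∀ z ∈ U, P z * P z = -1) (m : Fin 4) :
    covD G P m y * P y + P y * covD G P m y = 0 := by
  rw [h.covD_mul hy hP hP hR]
  simp [covD, pdM_const]

end LocalMetric

namespace LocalTriple

variable (h : LocalTriple U G A B C)
include h

lemma rotate : LocalTriple U G B C A :=
  { h.toLocalMetric with
    smoothA := h.smoothB, smoothB := h.smoothC, smoothC := h.smoothA, skewA := h.skewB,
    skewB := h.skewC, skewC := h.skewA, quat := fun y hy => (h.quat y hy).rotate }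

lemma smoothI : MSmooth U (acs G A) := h.smooth_acs h.smoothA

lemma hermitian (hy : y ∈ U) :
    IsHermitianTriple (G y) (acs G A y) (acs G B y) (acs G C y) :=
  { h.quat y hy with
    symm := h.symm y hy
    pos := h.pos y hy
    skewI := by rw [h.mul_acs hy]; exact h.skewA y hy
    skewJ := by rw [h.mul_acs hy]; exact h.skewB y hy
    skewK := by rw [h.mul_acs hy]; exact h.skewC y hy }

/-- The covariant derivatives of the triple are given by the `SU(2)` connection. -/
theorem covD_eq (hy : y ∈ U) (m : Fin 4) :
    covD G (acs G A) m y
      = -(connForm G C A m y • acs G C y - connForm G A B m y • acs G B y) :=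
  (h.hermitian hy).derivation_fst (h.covD_skew hy h.smoothA h.skewA m)
    (h.covD_sq hy h.smoothI (fun z hz => (h.quat z hz).II) m)
    (h.covD_sq hy h.rotate.smoothI (fun z hz => (h.quat z hz).JJ) m)
    (h.covD_mul hy h.rotate.rotate.smoothI h.smoothI (fun z hz => (h.quat z hz).KI) m)

lemma pdM_acs (hy : y ∈ U) (m : Fin 4) :
    pdM m (acs G A) y = acs G A y * gam G m y - gam G m y * acs G A y
      - (connForm G C A m y • acs G C y - connForm G A B m y • acs G B y) := by
  have := h.covD_eq hy m
  rw [covD] at this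
  rw [sub_eq_add_neg (_ - _), ← this]; abel

lemma pdM_form (hy : y ∈ U) (m : Fin 4) :
    pdM m A y = (gam G m y)ᵀ * A y + A y * gam G m y
      - (connForm G C A m y • C y - connForm G A B m y • B y) := by
  have e := h.mul_covD hy h.smoothA m
  rw [h.covD_eq hy m, Matrix.mul_neg, Matrix.mul_sub, Matrix.mul_smul, Matrix.mul_smul,
    h.mul_acs hy, h.mul_acs hy] at e
  rw [sub_eq_add_neg _ (_ - _), e]; abel

/-- The structure equation `d^A Σ = 0`. -/
theorem structure_eq (hy : y ∈ U) (μ ν ρ : Fin 4) :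
    pd μ (fun z => A z ν ρ) y + pd ν (fun z => A z ρ μ) y + pd ρ (fun z => A z μ ν) y
      + (wedge (fun m => connForm G C A m y) (C y) μ ν ρ
        - wedge (fun m => connForm G A B m y) (B y) μ ν ρ) = 0 := by
  have hs : ∀ i j, A y j i = -A y i j := fun i j => congrFun (congrFun (h.skewA y hy) i) j
  have hg : ∀ i j r, gam G i y r j = gam G j y r i := fun i j r =>
    h.christoffel_symm hy r i j
  have e1 : ∀ i j k, ((gam G i y)ᵀ * A y) j k = -(A y * gam G j y) k i := by
    intro i j k
    simp only [Matrix.mul_apply, Matrix.transpose_apply, ← Finset.sum_neg_distrib]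
    refine Finset.sum_congr rfl fun r _ => ?_
    rw [hg i j r, hs k r]; ring
  have e2 : ∀ i j k, pd i (fun z => A z j k) y = -(A y * gam G j y) k i + (A y * gam G i y) j k
      - (connForm G C A i y * C y j k - connForm G A B i y * B y j k) := by
    intro i j k
    rw [← pdM_apply, h.pdM_form hy, ← e1]
    rfl
  -- Vanishing torsion: in the cyclic sum all Christoffel terms cancel in pairs and only the
  -- rotation terms remain.
  have e3 : ∀ i j k, (A y * gam G i y) j k = (A y * gam G k y) j i := by
    intro i j k
    simp only [Matrix.mul_apply, hg i k]
  rw [e2, e2, e2, wedge, wedge, e3 μ ν ρ, e3 ν ρ μ, e3 ρ μ ν]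
  ring

/-- The curvature of the `SU(2)` connection and the Riemann curvature. -/
theorem curvM_commutator (hy : y ∈ U) (m n : Fin 4) :
    curvM G m n y * acs G A y - acs G A y * curvM G m n y
      = -(curvForm (connForm G C A) (connForm G A B) (connForm G B C) y m n • acs G C y
        - curvForm (connForm G A B) (connForm G B C) (connForm G C A) y m n • acs G B y) := by
  have hU := h.isOpen
  have sI := h.smoothI
  have sJ := h.rotate.smoothI
  have sK := h.rotate.rotate.smoothI
  have sb := h.smooth_connForm h.smoothC h.smoothA
  have sc := h.smooth_connForm h.smoothA h.smoothB
  have key : ∀ k l, pdM k (pdM l (acs G A)) y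
      = pdM k (acs G A) y * gam G l y + acs G A y * pdM k (gam G l) y
        - (pdM k (gam G l) y * acs G A y + gam G l y * pdM k (acs G A) y)
        - (pd k (connForm G C A l) y • acs G C y + connForm G C A l y • pdM k (acs G C) y
          - (pd k (connForm G A B l) y • acs G B y + connForm G A B l y • pdM k (acs G B) y)) := by
    intro k l
    have hl := h.smooth_gam l
    rw [pdM_congr hU hy (fun _ hz => h.pdM_acs hz l) k,
      pdM_sub hU hy ((sI.mul hl).sub (hl.mul sI))
        ((MSmooth.smul (sb l) sK).sub (MSmooth.smul (sc l) sJ)),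
      pdM_sub hU hy (sI.mul hl) (hl.mul sI),
      pdM_sub hU hy (MSmooth.smul (sb l) sK) (MSmooth.smul (sc l) sJ),
      pdM_mul hU hy sI hl, pdM_mul hU hy hl sI, pdM_smul hU hy (sb l) sK,
      pdM_smul hU hy (sc l) sJ]
  have h1 := key m n
  -- Integrability: mixed second derivatives of `I` agree. Substituting the first-order equations
  -- once more leaves the Riemann commutator on one side and the curvature of `a, b, c` on the
  -- other.
  rw [pdM_comm hU hy sI, key n m, ← sub_eq_zero] at h1
  simp only [h.pdM_acs hy, h.rotate.pdM_acs hy, h.rotate.rotate.pdM_acs hy] at h1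
  rw [← sub_eq_zero, ← h1, curvM]
  simp only [curvForm, Matrix.of_apply, Matrix.mul_add, Matrix.mul_sub, Matrix.add_mul,
    Matrix.sub_mul, Matrix.mul_assoc, Matrix.smul_mul, Matrix.mul_smul]
  module

/-- The `SU(2)` curvature as a component of the Riemann curvature. -/
theorem curvForm_eq_trace (hy : y ∈ U) (m n : Fin 4) :
    curvForm (connForm G B C) (connForm G C A) (connForm G A B) y m n
      = -(1 / 2) * (curvM G m n y * acs G A y).trace := by
  -- Pairing `[R, J]` with `K` gives `2 tr(RI)` by `JK = I = -KJ`. On the other side only the `K`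
  -- term survives, with `tr(K²) = -4`.
  have e := congrArg (fun Z => (Z * acs G C y).trace) (h.rotate.curvM_commutator hy m n)
  have q := h.quat y hy
  simp only [Matrix.sub_mul, Matrix.neg_mul, Matrix.trace_sub, Matrix.trace_neg, Matrix.smul_mul,
    Matrix.trace_smul, smul_eq_mul] at e
  rw [q.rotate.rotate.trace_JI, q.rotate.rotate.trace_sq, Matrix.mul_assoc, q.JK,
    Matrix.mul_assoc, Matrix.trace_mul_comm (acs G B y), Matrix.mul_assoc, q.KJ, Matrix.mul_neg,
    Matrix.trace_neg] at e
  linarith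

end LocalTriple

end SelfDualGeometry
-- The Einstein equation and the self-dual Weyl curvature
namespace SelfDualGeometry

open Matrix

variable {U : Set R4} {y : R4} {G A B C : R4 → Mat4} {L : ℝ}

/-- The two-form `(1/2) R_{ab mn} A^{ab}`. -/
noncomputable def curvContract (G A : R4 → Mat4) (y : R4) : Mat4 :=
  Matrix.of fun m n => -(1 / 2) * (curvM G m n y * acs G A y).trace

lemma curvContract_antisymm (G A : R4 → Mat4) (y : R4) (i j : Fin 4) :
    curvContract G A y i j = -curvContract G A y j i := by
  simp only [curvContract, Matrix.of_apply]
  rw [curvM_antisymm, Matrix.neg_mul, Matrix.trace_neg]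
  ring

lemma curvContract_skew (G A : R4 → Mat4) (y : R4) :
    (curvContract G A y)ᵀ = -curvContract G A y := by
  ext i j
  exact curvContract_antisymm G A y j i

lemma acs_eq_raised_mul (h : LocalMetric U G) (hy : y ∈ U) (A : R4 → Mat4) :
    acs G A y = raised G A y * G y := by
  rw [raised, Matrix.mul_assoc, h.inv_mul hy, Matrix.mul_one, acs]

namespace LocalMetric

variable (h : LocalMetric U G)
include h

lemma raised_skew (hy : y ∈ U) (hs : (A y)ᵀ = -A y) : (raised G A y)ᵀ = -raised G A y := by
  rw [raised, Matrix.transpose_mul, Matrix.transpose_mul, hs, h.inv_symm hy]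
  simp [Matrix.mul_assoc]

lemma raised_skew_apply (hy : y ∈ U) (hs : (A y)ᵀ = -A y) (i j : Fin 4) :
    raised G A y i j = -raised G A y j i :=
  congrFun (congrFun (h.raised_skew hy hs) j) i

lemma sum_acs_mul (hy : y ∈ U) (s n : Fin 4) :
    ∑ m, (acs G A y * curvM G m n y) m s
      = ∑ m, ∑ u, raised G A y m u * riemannLow G u s m n y := by
  refine Finset.sum_congr rfl fun m _ => ?_
  rw [acs_eq_raised_mul h hy, Matrix.mul_assoc, Matrix.mul_apply]
  simp only [riemannLow_eq]

lemma sum_acs_mul_antisymm (hy : y ∈ U) (hs : (A y)ᵀ = -A y) (s n : Fin 4) :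
    ∑ m, (acs G A y * curvM G m n y) m s = -∑ m, (acs G A y * curvM G m s y) m n := by
  rw [h.sum_acs_mul hy, h.sum_acs_mul hy, Finset.sum_comm]
  simp only [← Finset.sum_neg_distrib]
  refine Finset.sum_congr rfl fun u _ => Finset.sum_congr rfl fun m _ => ?_
  rw [h.riemannLow_pair_symm hy u s m n, h.raised_skew_apply hy hs]
  ring

/-- The first Bianchi identity relates this contraction to its transpose plus a trace. It is
antisymmetric by pair symmetry, so it equals half that trace. -/
lemma sum_acs_mul_eq (hy : y ∈ U) (hs : (A y)ᵀ = -A y) (s n : Fin 4) :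
    ∑ m, (acs G A y * curvM G m n y) m s = curvContract G A y n s := by
  have h1 : ∑ m, (acs G A y * curvM G m n y) m s
      = -(curvM G n s y * acs G A y).trace + ∑ m, (acs G A y * curvM G m s y) m n := by
    rw [Matrix.trace_mul_comm, Matrix.trace]
    simp only [Matrix.diag_apply, Matrix.mul_apply, ← Finset.sum_neg_distrib,
      ← Finset.sum_add_distrib]
    refine Finset.sum_congr rfl fun m _ => Finset.sum_congr rfl fun t _ => ?_
    have b := h.bianchi hy t s m n
    rw [curvM_antisymm G y s m, Matrix.neg_apply] at b
    rw [show curvM G m n y t s = -curvM G n s y t m + curvM G m s y t n by linarith]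
    ring
  have h2 := h.sum_acs_mul_antisymm hy hs s n
  simp only [curvContract, Matrix.of_apply]
  linarith

lemma curvContract_eq_sum (hy : y ∈ U) (r s : Fin 4) :
    curvContract G A y r s
      = (1 / 2) * ∑ m, ∑ n, riemannLow G m n r s y * raised G A y m n := by
  have e : (curvM G r s y * acs G A y).trace = ((G y * curvM G r s y) * raised G A y).trace := by
    rw [acs_eq_raised_mul h hy, ← Matrix.mul_assoc, Matrix.trace_mul_comm, ← Matrix.mul_assoc]
  rw [curvContract, Matrix.of_apply, e, ← Matrix.trace_transpose, Matrix.transpose_mul,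
    h.curvM_skew hy, Matrix.mul_neg, Matrix.trace_neg, Matrix.trace_mul_comm, Matrix.trace]
  simp only [Matrix.diag_apply, Matrix.mul_apply (M := G y * _), Matrix.transpose_apply,
    ← riemannLow_eq]
  ring

lemma scalarCurv_of_einstein (hy : y ∈ U) (hE : ∀ m n, ricci G m n y = L * G y m n) :
    scalarCurv G y = 4 * L := by
  have : scalarCurv G y = L * ((G y)⁻¹ * G y).trace := by
    simp only [scalarCurv, hE, Matrix.trace, Matrix.diag_apply, Matrix.mul_apply, Finset.mul_sum]
    refine Finset.sum_congr rfl fun s _ => Finset.sum_congr rfl fun n _ => ?_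
    rw [h.symm_apply hy s n]; ring
  rw [this, h.inv_mul hy]
  simp [Matrix.trace_one]; ring

lemma weyl_of_einstein (hy : y ∈ U) (hE : ∀ m n, ricci G m n y = L * G y m n) (a b c d : Fin 4) :
    weyl G a b c d y
      = riemannLow G a b c d y - L / 3 * (G y a c * G y b d - G y a d * G y b c) := by
  rw [weyl, h.scalarCurv_of_einstein hy hE, hE, hE, hE, hE]
  ring

/-- The contraction of the Weyl tensor of an Einstein metric with two two-forms. -/
theorem weyl_contract (hy : y ∈ U) (hE : ∀ m n, ricci G m n y = L * G y m n)
    (hB : (B y)ᵀ = -B y) :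
    (1 / 8) * ∑ m, ∑ n, ∑ r, ∑ s, weyl G m n r s y * raised G A y m n * raised G B y r s
      = -(1 / 4) * ((G y)⁻¹ * curvContract G A y * acs G B y).trace
        + L / 12 * (acs G A y * acs G B y).trace := by
  set P := raised G A y with hP
  set Q := raised G B y with hQ
  have hQs := h.raised_skew_apply hy hB
  rw [← hQ] at hQs
  have gq : G y * Q * G y = B y := by
    rw [hQ, raised, Matrix.mul_assoc, Matrix.mul_assoc, h.inv_mul hy, Matrix.mul_one,
      ← Matrix.mul_assoc, h.mul_inv hy, Matrix.one_mul]
  have e1 : ∑ m, ∑ n, ∑ r, ∑ s, riemannLow G m n r s y * P m n * Q r s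
      = -2 * ((G y)⁻¹ * curvContract G A y * acs G B y).trace := by
    have t : ((G y)⁻¹ * curvContract G A y * acs G B y).trace
        = (curvContract G A y * Q).trace := by
      rw [Matrix.mul_assoc, Matrix.trace_mul_comm, hQ, raised, acs]
      simp only [Matrix.mul_assoc]
    rw [t, Matrix.trace]
    simp only [Matrix.diag_apply, Matrix.mul_apply, h.curvContract_eq_sum hy, Finset.mul_sum,
      Finset.sum_mul]
    calc _ = ∑ m, ∑ r, ∑ n, ∑ s, riemannLow G m n r s y * P m n * Q r s :=
          Finset.sum_congr rfl fun m _ => Finset.sum_comm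
      _ = ∑ r, ∑ m, ∑ n, ∑ s, riemannLow G m n r s y * P m n * Q r s := Finset.sum_comm
      _ = ∑ r, ∑ m, ∑ s, ∑ n, riemannLow G m n r s y * P m n * Q r s :=
          Finset.sum_congr rfl fun r _ => Finset.sum_congr rfl fun m _ => Finset.sum_comm
      _ = ∑ r, ∑ s, ∑ m, ∑ n, riemannLow G m n r s y * P m n * Q r s :=
          Finset.sum_congr rfl fun r _ => Finset.sum_comm
      _ = _ := by
          refine Finset.sum_congr rfl fun r _ => Finset.sum_congr rfl fun s _ =>
            Finset.sum_congr rfl fun m _ => Finset.sum_congr rfl fun n _ => ?_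
          rw [hQs r s, ← hP]; ring
  have e2 : ∀ m n, ∑ r, ∑ s, (G y m r * G y n s - G y m s * G y n r) * Q r s = 2 * B y m n := by
    intro m n
    have f1 : ∑ r, ∑ s, G y m r * G y n s * Q r s = B y m n := by
      conv_rhs => rw [← gq]
      simp only [Matrix.mul_apply, Finset.sum_mul]
      rw [Finset.sum_comm]
      refine Finset.sum_congr rfl fun s _ => Finset.sum_congr rfl fun r _ => ?_
      rw [h.symm_apply hy n s]; ring
    have f2 : ∑ r, ∑ s, G y m s * G y n r * Q r s = -B y m n := by
      rw [← f1, Finset.sum_comm]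
      simp only [← Finset.sum_neg_distrib]
      refine Finset.sum_congr rfl fun s _ => Finset.sum_congr rfl fun r _ => ?_
      rw [hQs r s]; ring
    simp only [sub_mul, Finset.sum_sub_distrib, f1, f2]
    ring
  have e3 : ∑ m, ∑ n, ∑ r, ∑ s, (G y m r * G y n s - G y m s * G y n r) * P m n * Q r s
      = -2 * (acs G A y * acs G B y).trace := by
    have t : (acs G A y * acs G B y).trace = (P * B y).trace := by
      rw [hP, raised, acs, acs]; simp only [Matrix.mul_assoc]
    have hBs : ∀ i j, B y i j = -B y j i := fun i j => congrFun (congrFun hB j) i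
    rw [t, Matrix.trace]
    simp only [Matrix.diag_apply, Matrix.mul_apply, Finset.mul_sum]
    refine Finset.sum_congr rfl fun m _ => Finset.sum_congr rfl fun n _ => ?_
    calc _ = P m n * ∑ r, ∑ s, (G y m r * G y n s - G y m s * G y n r) * Q r s := by
          simp only [Finset.mul_sum]
          refine Finset.sum_congr rfl fun r _ => Finset.sum_congr rfl fun s _ => ?_
          ring
      _ = _ := by rw [e2, hBs m n]; ring
  have hw : ∀ m n r s, weyl G m n r s y * P m n * Q r s = riemannLow G m n r s y * P m n * Q r s
      - L / 3 * ((G y m r * G y n s - G y m s * G y n r) * P m n * Q r s) := fun m n r s => by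
    rw [h.weyl_of_einstein hy hE]; ring
  simp only [hw, Finset.sum_sub_distrib, ← Finset.mul_sum]
  rw [e1, e3]
  ring

end LocalMetric

namespace LocalTriple

variable (h : LocalTriple U G A B C)
include h

lemma curvForm_eq (hy : y ∈ U) :
    curvForm (connForm G B C) (connForm G C A) (connForm G A B) y = curvContract G A y := by
  ext m n
  rw [h.curvForm_eq_trace hy]; rfl

/-- The Einstein equation in terms of the `SU(2)` curvature. -/
theorem einstein_contract (hy : y ∈ U) (hE : ∀ m n, ricci G m n y = L * G y m n) :
    L • A y = curvContract G A y + curvContract G B y * acs G C y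
      - curvContract G C y * acs G B y := by
  ext n s
  -- The Ricci-type trace of the commutator formula: the first product gives `Ric` composed with
  -- `I`, the second gives the curvature two-form by `sum_acs_mul_eq`.
  have e : ∑ m, (curvM G m n y * acs G A y - acs G A y * curvM G m n y) m s
      = ∑ m, (-(curvContract G B y m n • acs G C y - curvContract G C y m n • acs G B y)) m s := by
    refine Finset.sum_congr rfl fun m _ => ?_
    rw [h.curvM_commutator hy, h.rotate.curvForm_eq hy, h.rotate.rotate.curvForm_eq hy]
  have e1 : ∑ m, (curvM G m n y * acs G A y) m s = L * A y n s := by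
    rw [← h.mul_acs hy A]
    simp only [Matrix.mul_apply, Finset.mul_sum]
    rw [Finset.sum_comm]
    refine Finset.sum_congr rfl fun t _ => ?_
    rw [← Finset.sum_mul, h.symm_apply hy n t, ← mul_assoc, ← hE, ricci]
    simp only [curvM_apply]
  have hs : ∀ X : R4 → Mat4, ∀ m, curvContract G X y m n = -curvContract G X y n m := fun X m =>
    curvContract_antisymm G X y m n
  simp only [Matrix.sub_apply, Finset.sum_sub_distrib, e1, h.sum_acs_mul_eq hy (h.skewA y hy)] at e
  simp only [Matrix.sub_apply, Matrix.add_apply, Matrix.smul_apply, smul_eq_mul, Matrix.mul_apply]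
  rw [show L * A y n s = curvContract G A y n s + (L * A y n s - curvContract G A y n s) by ring, e]
  simp only [Matrix.neg_apply, Matrix.sub_apply, Matrix.smul_apply, smul_eq_mul, hs B, hs C]
  rw [add_sub_assoc, ← Finset.sum_sub_distrib]
  congr 1
  refine Finset.sum_congr rfl fun m _ => ?_
  ring

/-- Right multiplication of `einstein_contract` by `I`, using `KI = J` and `JI = -K`, gives the
symmetric form that `eq_tripleProj_fst` requires. -/
lemma einstein_sum (hy : y ∈ U) (hE : ∀ m n, ricci G m n y = L * G y m n) :
    (G y)⁻¹ * curvContract G A y * acs G A y + (G y)⁻¹ * curvContract G B y * acs G B y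
      + (G y)⁻¹ * curvContract G C y * acs G C y = (-L) • (1 : Mat4) := by
  have q := h.quat y hy
  have e := congrArg (fun Z => (G y)⁻¹ * Z * acs G A y) (h.einstein_contract hy hE)
  simp only [Matrix.mul_add, Matrix.mul_sub, Matrix.add_mul, Matrix.sub_mul, Matrix.mul_smul,
    Matrix.smul_mul, Matrix.mul_assoc, q.KI, q.JI, Matrix.mul_neg] at e
  have e1 : (G y)⁻¹ * (A y * acs G A y) = -1 := by
    rw [← Matrix.mul_assoc, ← q.II, acs]
  rw [e1] at e
  simp only [Matrix.mul_assoc]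
  rw [neg_smul, ← smul_neg, e]
  abel

/-- The `SU(2)` curvature of an Einstein metric is self-dual. -/
theorem curvContract_proj (hy : y ∈ U) (hE : ∀ m n, ricci G m n y = L * G y m n) :
    (G y)⁻¹ * curvContract G A y
      = tripleProj (acs G A y) (acs G B y) (acs G C y) ((G y)⁻¹ * curvContract G A y) := by
  have hs : ∀ X : R4 → Mat4, (G y * ((G y)⁻¹ * curvContract G X y))ᵀ
      = -(G y * ((G y)⁻¹ * curvContract G X y)) := by
    intro X
    rw [← Matrix.mul_assoc, h.mul_inv hy, Matrix.one_mul, curvContract_skew]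
  exact (h.hermitian hy).eq_tripleProj_fst (hs A) (hs B) (hs C) (h.einstein_sum hy hE)

/-- The `SU(2)` curvature of an Einstein metric in terms of the self-dual Weyl curvature. -/
theorem curvContract_eq_weyl (hy : y ∈ U) (hE : ∀ m n, ricci G m n y = L * G y m n) :
    curvContract G A y
      = ((1 / 8) * ∑ m, ∑ n, ∑ r, ∑ s, weyl G m n r s y * raised G A y m n * raised G A y r s
          + L / 3) • A y
        + ((1 / 8) * ∑ m, ∑ n, ∑ r, ∑ s,
            weyl G m n r s y * raised G A y m n * raised G B y r s) • B y
        + ((1 / 8) * ∑ m, ∑ n, ∑ r, ∑ s,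
            weyl G m n r s y * raised G A y m n * raised G C y r s) • C y := by
  have q := h.quat y hy
  have sA := h.skewA y hy
  have e := congrArg (fun Z => G y * Z) (h.curvContract_proj hy hE)
  simp only [← Matrix.mul_assoc, h.mul_inv hy, Matrix.one_mul] at e
  rw [e, h.weyl_contract hy hE sA, h.weyl_contract hy hE (h.skewB y hy),
    h.weyl_contract hy hE (h.skewC y hy), q.trace_sq, q.trace_IJ, q.rotate.rotate.trace_JI,
    tripleProj]
  simp only [Matrix.mul_smul, Matrix.mul_add, h.mul_acs hy]
  module

end LocalTriple

end SelfDualGeometry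
namespace SelfDualGeometry

open Matrix

variable {U : Set R4} {y : R4} {G A B C : R4 → Mat4}

/-! ### The Bianchi identity of the `SU(2)` curvature -/

/-- `d(da)` vanishes by symmetry of second derivatives, and the cubic terms cancel. Any three smooth
one-forms will do. -/
lemma curvForm_bianchi (hU : IsOpen U) (hy : y ∈ U) {a b c : Fin 4 → R4 → ℝ}
    (ha : ∀ m, ContDiffOn ℝ ∞ (a m) U) (hb : ∀ m, ContDiffOn ℝ ∞ (b m) U)
    (hc : ∀ m, ContDiffOn ℝ ∞ (c m) U) (μ ν ρ : Fin 4) :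
    pd μ (fun z => curvForm a b c z ν ρ) y + pd ν (fun z => curvForm a b c z ρ μ) y
      + pd ρ (fun z => curvForm a b c z μ ν) y
      + (wedge (fun m => b m y) (curvForm c a b y) μ ν ρ
        - wedge (fun m => c m y) (curvForm b c a y) μ ν ρ) = 0 := by
  have key : ∀ k m n, pd k (fun z => curvForm a b c z m n) y
      = pd k (pd m (a n)) y - pd k (pd n (a m)) y
        + ((pd k (b m) y * c n y + b m y * pd k (c n) y)
          - (pd k (b n) y * c m y + b n y * pd k (c m) y)) := by
    intro k m n
    have s := fun i j => contDiffOn_pd hU (ha j) i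
    have t := fun i j => (hb i).mul (hc j)
    simp only [curvForm, Matrix.of_apply]
    rw [pd_add hU hy ((s m n).sub (s n m)) ((t m n).sub (t n m)), pd_sub hU hy (s m n) (s n m),
      pd_sub hU hy (t m n) (t n m), pd_mul hU hy (hb m) (hc n), pd_mul hU hy (hb n) (hc m)]
  rw [key, key, key]
  simp only [wedge, curvForm, Matrix.of_apply]
  rw [pd_comm hU hy (ha ρ) μ ν, pd_comm hU hy (ha ν) μ ρ, pd_comm hU hy (ha μ) ν ρ]
  ring

namespace LocalTriple

variable (h : LocalTriple U G A B C)
include h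

lemma raised_mul (hy : y ∈ U) : raised G A y * A y = -1 ∧ raised G A y * B y = acs G C y ∧
    raised G A y * C y = -acs G B y := by
  have q := h.quat y hy
  have e : ∀ X : R4 → Mat4, raised G A y * X y = acs G A y * acs G X y := fun X => by
    rw [raised, acs, acs]; simp only [Matrix.mul_assoc]
  exact ⟨(e A).trans q.II, (e B).trans q.IJ, (e C).trans q.IK⟩

lemma contract_wedge_fst (hy : y ∈ U) (a : Fin 4 → ℝ) (μ : Fin 4) :
    ∑ ν, ∑ ρ, raised G A y ν ρ * wedge a (A y) μ ν ρ = 2 * a μ := by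
  rw [contract_wedge a (h.skewA y hy) (h.raised_skew hy (h.skewA y hy)) (h.raised_mul hy).1]
  simp [Matrix.trace_one, Matrix.vecMul_neg]
  ring

lemma contract_wedge_snd (hy : y ∈ U) (a : Fin 4 → ℝ) (μ : Fin 4) :
    ∑ ν, ∑ ρ, raised G A y ν ρ * wedge a (B y) μ ν ρ = 2 * (a ᵥ* acs G C y) μ := by
  rw [contract_wedge a (h.skewB y hy) (h.raised_skew hy (h.skewA y hy)) (h.raised_mul hy).2.1,
    (h.quat y hy).rotate.rotate.trace_fst]
  ring

lemma contract_wedge_trd (hy : y ∈ U) (a : Fin 4 → ℝ) (μ : Fin 4) :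
    ∑ ν, ∑ ρ, raised G A y ν ρ * wedge a (C y) μ ν ρ = -2 * (a ᵥ* acs G B y) μ := by
  rw [contract_wedge a (h.skewC y hy) (h.raised_skew hy (h.skewA y hy)) (h.raised_mul hy).2.2,
    Matrix.trace_neg, (h.quat y hy).rotate.trace_fst, Matrix.vecMul_neg]
  simp

/-- The Bianchi identity when the `SU(2)` curvature is diagonal. -/
theorem pd_curvature_eigenvalue (hy : y ∈ U) {φ : R4 → ℝ} {χ ψ : ℝ} (hφ : ContDiffOn ℝ ∞ φ U)
    (hA : ∀ z ∈ U, curvContract G A z = φ z • A z) (hB : curvContract G B y = χ • B y)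
    (hC : curvContract G C y = ψ • C y) (μ : Fin 4) :
    pd μ φ y = (ψ - φ y) * ((fun m => connForm G C A m y) ᵥ* acs G B y) μ
      + (χ - φ y) * ((fun m => connForm G A B m y) ᵥ* acs G C y) μ := by
  have hU := h.isOpen
  have key : ∀ ν ρ, wedge (fun m => pd m φ y) (A y) μ ν ρ
      + (ψ - φ y) * wedge (fun m => connForm G C A m y) (C y) μ ν ρ
      - (χ - φ y) * wedge (fun m => connForm G A B m y) (B y) μ ν ρ = 0 := by
    intro ν ρ
    have e := curvForm_bianchi hU hy (h.smooth_connForm h.smoothB h.smoothC)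
      (h.smooth_connForm h.smoothC h.smoothA) (h.smooth_connForm h.smoothA h.smoothB) μ ν ρ
    have d : ∀ k m n, pd k (fun z => curvForm (connForm G B C) (connForm G C A) (connForm G A B)
        z m n) y = pd k φ y * A y m n + φ y * pd k (fun z => A z m n) y := by
      intro k m n
      rw [← pd_mul hU hy hφ (h.smoothA m n)]
      refine pd_congr hU hy (fun z hz => ?_) k
      rw [h.curvForm_eq hz, hA z hz]; rfl
    rw [d, d, d, h.rotate.curvForm_eq hy, h.rotate.rotate.curvForm_eq hy, hB, hC] at e
    have s := h.structure_eq hy μ ν ρ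
    simp only [wedge, Matrix.smul_apply, smul_eq_mul] at e s ⊢
    -- Subtracting `φ` times the structure equation removes `dA`, leaving `dφ ∧ A` and the
    -- eigenvalue differences.
    linear_combination e - φ y * s
  have e : ∑ ν, ∑ ρ, raised G A y ν ρ * (wedge (fun m => pd m φ y) (A y) μ ν ρ
      + (ψ - φ y) * wedge (fun m => connForm G C A m y) (C y) μ ν ρ
      - (χ - φ y) * wedge (fun m => connForm G A B m y) (B y) μ ν ρ) = 0 := by
    simp only [key, mul_zero, Finset.sum_const_zero]
  simp only [mul_add, mul_sub, Finset.sum_add_distrib, Finset.sum_sub_distrib,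
    mul_left_comm (raised G A y _ _) (_ - _), ← Finset.mul_sum] at e
  simp only [h.contract_wedge_fst hy, h.contract_wedge_snd hy, h.contract_wedge_trd hy] at e
  linarith

end LocalTriple

/-! ### Lie derivatives -/

/-- The matrix `∂_ν X^k`. -/
noncomputable def jac (X : R4 → Fin 4 → ℝ) (y : R4) : Mat4 :=
  Matrix.of fun k ν => pd ν (fun z => X z k) y

/-- The directional derivative of a matrix valued function. -/
noncomputable def dirD (X : R4 → Fin 4 → ℝ) (S : R4 → Mat4) (y : R4) : Mat4 :=
  ∑ k, X y k • pdM k S y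

/-- The Lie derivative of a covariant two-tensor. -/
noncomputable def lieM (X : R4 → Fin 4 → ℝ) (S : R4 → Mat4) (y : R4) : Mat4 :=
  dirD X S y + (jac X y)ᵀ * S y + S y * jac X y

/-- The Lie derivative of an endomorphism. -/
noncomputable def lieE (X : R4 → Fin 4 → ℝ) (S : R4 → Mat4) (y : R4) : Mat4 :=
  dirD X S y - jac X y * S y + S y * jac X y

/-- The components of `b ∧ e` for one-forms. -/
def wedgeOne (b e : Fin 4 → ℝ) (μ ν : Fin 4) : ℝ := b μ * e ν - b ν * e μ

lemma lieDerivMetric_eq (X : R4 → Fin 4 → ℝ) (G : R4 → Mat4) (y : R4) (μ ν : Fin 4) :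
    lieDerivMetric G X μ ν y = lieM X G y μ ν := by
  simp only [lieDerivMetric, lieM, dirD, jac, Matrix.add_apply, Matrix.sum_apply, Matrix.smul_apply,
    Matrix.mul_apply, Matrix.transpose_apply, Matrix.of_apply, pdM_apply, smul_eq_mul,
    ← Finset.sum_add_distrib]
  exact Finset.sum_congr rfl fun k _ => by ring

lemma dirD_mul (hU : IsOpen U) (hy : y ∈ U) (X : R4 → Fin 4 → ℝ) {P Q R : R4 → Mat4}
    (hP : MSmooth U P) (hQ : MSmooth U Q) (hR : ∀ z ∈ U, P z * Q z = R z) :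
    dirD X R y = dirD X P y * Q y + P y * dirD X Q y := by
  simp only [dirD, Finset.sum_mul, Finset.mul_sum, ← Finset.sum_add_distrib]
  refine Finset.sum_congr rfl fun k _ => ?_
  rw [pdM_congr hU hy (fun z hz => (hR z hz).symm) k, pdM_mul hU hy hP hQ]
  simp only [smul_add, Matrix.smul_mul, Matrix.mul_smul]

lemma lieM_mul (hU : IsOpen U) (hy : y ∈ U) (X : R4 → Fin 4 → ℝ) {P Q R : R4 → Mat4}
    (hP : MSmooth U P) (hQ : MSmooth U Q) (hR : ∀ z ∈ U, P z * Q z = R z) :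
    lieM X R y = lieM X P y * Q y + P y * lieE X Q y := by
  rw [lieM, lieM, lieE, dirD_mul hU hy X hP hQ hR, ← hR y hy]
  simp only [Matrix.mul_add, Matrix.mul_sub, Matrix.add_mul, Matrix.mul_assoc]
  abel

namespace LocalTriple

variable (h : LocalTriple U G A B C)
include h

/-- The covariant Cartan formula for the Lie derivative of the triple. -/
theorem lieM_form (hy : y ∈ U) {X : R4 → Fin 4 → ℝ}
    (hX : ∀ k, ContDiffOn ℝ ∞ (fun z => X z k) U) (μ ν : Fin 4) :
    lieM X A y μ ν
      = (∑ k, X y k * connForm G A B k y) * B y μ ν - (∑ k, X y k * connForm G C A k y) * C y μ ν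
        + (pd μ (fun z => (X z ᵥ* A z) ν) y - pd ν (fun z => (X z ᵥ* A z) μ) y
          + (wedgeOne (fun m => connForm G C A m y) (X y ᵥ* C y) μ ν
            - wedgeOne (fun m => connForm G A B m y) (X y ᵥ* B y) μ ν)) := by
  have hU := h.isOpen
  have e : ∀ m n, pd m (fun z => (X z ᵥ* A z) n) y
      = ∑ k, (pd m (fun z => X z k) y * A y k n + X y k * pd m (fun z => A z k n) y) := by
    intro m n
    simp only [Matrix.vecMul, dotProduct]
    rw [pd_sum _ hU hy (fun k => (hX k).mul (h.smoothA k n))]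
    exact Finset.sum_congr rfl fun k _ => pd_mul hU hy (hX k) (h.smoothA k n) m
  have sA : ∀ i j, A y i j = -A y j i := fun i j => congrFun (congrFun (h.skewA y hy) j) i
  have sB : ∀ i j, B y i j = -B y j i := fun i j => congrFun (congrFun (h.skewB y hy) j) i
  have sC : ∀ i j, C y i j = -C y j i := fun i j => congrFun (congrFun (h.skewC y hy) j) i
  have pA : ∀ m i j, pd m (fun z => A z i j) y = -pd m (fun z => A z j i) y := fun m i j => by
    rw [← pd_neg]
    exact pd_congr hU hy (fun z hz => congrFun (congrFun (h.skewA z hz) j) i) m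
  rw [e, e]
  simp only [wedgeOne, lieM, dirD, jac, Matrix.add_apply, Matrix.sum_apply, Matrix.smul_apply,
    Matrix.mul_apply, Matrix.transpose_apply, Matrix.of_apply, pdM_apply, smul_eq_mul,
    Matrix.vecMul, dotProduct, Finset.mul_sum, Finset.sum_mul, ← Finset.sum_add_distrib,
    ← Finset.sum_sub_distrib]
  refine Finset.sum_congr rfl fun k _ => ?_
  -- Contracting `d^A Σ = 0` with `X` turns the transport term of the Lie derivative into the
  -- exterior derivative of the contraction plus connection terms.
  have s := h.structure_eq hy k μ ν
  simp only [wedge] at s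
  rw [sA μ k]
  rw [pA μ ν k, sB ν k, sC ν k] at s
  linear_combination X y k * s

/-- An infinitesimal automorphism of the triple, up to rotations, preserves the metric. -/
theorem lieM_metric_eq_zero (hy : y ∈ U) {X : R4 → Fin 4 → ℝ} {a b c : ℝ}
    (hA : lieM X A y = c • B y - b • C y) (hB : lieM X B y = a • C y - c • A y)
    (hC : lieM X C y = b • A y - a • B y) : lieM X G y = 0 := by
  have hU := h.isOpen
  have q := h.quat y hy
  have sJ := h.rotate.smoothI
  have e1 := lieM_mul hU hy X h.smooth sJ (fun z hz => h.mul_acs hz B)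
  have e2 := lieM_mul hU hy X h.smoothA sJ (R := C) (fun z hz => by
    rw [← h.mul_acs hz A, Matrix.mul_assoc, (h.quat z hz).IJ, h.mul_acs hz])
  have e3 : lieE X (acs G B) y = (G y)⁻¹ * (lieM X B y - lieM X G y * acs G B y) := by
    rw [e1, add_sub_cancel_left, ← Matrix.mul_assoc, h.inv_mul hy, Matrix.one_mul]
  rw [e3, hA, hB, hC] at e2
  -- The Leibniz rule for `AJ = C`, with `L_X J` expressed by `L_X B` and `L_X G`, is linear in `L_X
  -- G`. This sandwich isolates it since `I² = J² = -1`; the rotation terms cancel.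
  have e4 := congrArg (fun Z => acs G A y * ((G y)⁻¹ * Z) * acs G B y) e2
  have i := fun Z : R4 → Mat4 => (show (G y)⁻¹ * Z y = acs G Z y from rfl)
  have i' := fun (Z : R4 → Mat4) (W : Mat4) =>
    (show (G y)⁻¹ * (Z y * W) = acs G Z y * W by rw [← Matrix.mul_assoc]; rfl)
  simp only [Matrix.mul_add, Matrix.mul_sub, Matrix.add_mul, Matrix.sub_mul, Matrix.mul_smul,
    Matrix.smul_mul, Matrix.mul_assoc, i, i', q.II, q.JJ, q.IJ, q.KJ, q.IK,
    IsQuaternionTriple.left_mul q.II, Matrix.mul_neg, Matrix.neg_mul, Matrix.mul_one,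
    Matrix.one_mul] at e4
  have e5 : acs G (lieM X G) y = 0 := by
    rw [← sub_eq_zero] at e4
    rw [← e4]
    module
  rw [← h.mul_acs hy (lieM X G), e5, Matrix.mul_zero]

end LocalTriple

end SelfDualGeometry
namespace SelfDualGeometry

open Matrix

variable {U : Set R4} {y : R4} {G A B C : R4 → Mat4} {α : R4 → ℝ} {L : ℝ}

/-! ### The inverse cube root -/

lemma invCbrt_of_pos {a : ℝ} (ha : 0 < a) : invCbrt a = a ^ (-(1 / 3) : ℝ) := by
  simp [invCbrt, sign_pos ha, abs_of_pos ha]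

lemma invCbrt_neg (a : ℝ) : invCbrt (-a) = -invCbrt a := by
  simp [invCbrt, Left.sign_neg]

lemma contDiffAt_invCbrt_of_pos {a : ℝ} (ha : 0 < a) : ContDiffAt ℝ ∞ invCbrt a :=
  (Real.contDiffAt_rpow_const_of_ne (p := -(1 / 3)) ha.ne').congr_of_eventuallyEq
    (Filter.eventuallyEq_of_mem (Ioi_mem_nhds ha) fun _ hb => invCbrt_of_pos hb)

lemma hasDerivAt_invCbrt_of_pos {a : ℝ} (ha : 0 < a) :
    HasDerivAt invCbrt (-(invCbrt a / (3 * a))) a := by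
  have h := (Real.hasDerivAt_rpow_const (p := -(1 / 3)) (Or.inl ha.ne')).congr_of_eventuallyEq
    (Filter.eventuallyEq_of_mem (Ioi_mem_nhds ha) fun _ hb => invCbrt_of_pos hb)
  refine h.congr_deriv ?_
  rw [invCbrt_of_pos ha, Real.rpow_sub_one ha.ne']
  ring

lemma contDiffAt_invCbrt {a : ℝ} (ha : a ≠ 0) : ContDiffAt ℝ ∞ invCbrt a := by
  rcases lt_or_gt_of_ne ha with h | h
  · have e : invCbrt = fun b => -invCbrt (-b) := by
      funext b; rw [invCbrt_neg, neg_neg]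
    rw [e]
    exact (ContDiffAt.comp a (contDiffAt_invCbrt_of_pos (neg_pos.mpr h)) contDiff_neg.contDiffAt).neg
  · exact contDiffAt_invCbrt_of_pos h

lemma hasDerivAt_invCbrt {a : ℝ} (ha : a ≠ 0) :
    HasDerivAt invCbrt (-(invCbrt a / (3 * a))) a := by
  rcases lt_or_gt_of_ne ha with h | h
  · have e : invCbrt = fun b => -invCbrt (-b) := by
      funext b; rw [invCbrt_neg, neg_neg]
    have d := ((hasDerivAt_invCbrt_of_pos (neg_pos.mpr h)).comp a (hasDerivAt_neg a)).neg
    rw [e]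
    refine HasDerivAt.congr_deriv d ?_
    field_simp
  · exact hasDerivAt_invCbrt_of_pos h

lemma contDiffOn_invCbrt_comp (hα : ContDiffOn ℝ ∞ α U) (h0 : ∀ y ∈ U, α y ≠ 0) :
    ContDiffOn ℝ ∞ (fun z => invCbrt (α z)) U := fun y hy =>
  (contDiffAt_invCbrt (h0 y hy)).comp_contDiffWithinAt y (hα y hy)

lemma pd_invCbrt_comp (hU : IsOpen U) (hy : y ∈ U) (hα : ContDiffOn ℝ ∞ α U)
    (h0 : α y ≠ 0) (m : Fin 4) :
    pd m (fun z => invCbrt (α z)) y = -(invCbrt (α y) / (3 * α y)) * pd m α y := by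
  have h := (hasDerivAt_invCbrt h0).comp_hasFDerivAt y
    (hα.differentiableAt_of_open hU hy).hasFDerivAt
  unfold pd
  rw [show (fun z => invCbrt (α z)) = invCbrt ∘ α from rfl, h.fderiv]
  rfl

/-! ### The structure equations determine the connection -/

/-- Two solutions of the same structure equation differ by a purely algebraic three-form;
contraction with `A` makes it a one-form relation. -/
lemma LocalTriple.structure_eq_snd_add_trd (h : LocalTriple U G A B C) (hy : y ∈ U)
    {b c : Fin 4 → ℝ}
    (he : ∀ μ ν ρ, pd μ (fun z => A z ν ρ) y + pd ν (fun z => A z ρ μ) y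
      + pd ρ (fun z => A z μ ν) y + (wedge b (C y) μ ν ρ - wedge c (B y) μ ν ρ) = 0) :
    (fun m => b m - connForm G C A m y) ᵥ* acs G B y
      + (fun m => c m - connForm G A B m y) ᵥ* acs G C y = 0 := by
  have key : ∀ μ ν ρ, wedge (fun m => b m - connForm G C A m y) (C y) μ ν ρ
      - wedge (fun m => c m - connForm G A B m y) (B y) μ ν ρ = 0 := by
    intro μ ν ρ
    have e1 := he μ ν ρ
    have e2 := h.structure_eq hy μ ν ρ
    simp only [wedge] at e1 e2 ⊢
    linear_combination e1 - e2
  funext μ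
  have e : ∑ ν, ∑ ρ, raised G A y ν ρ * (wedge (fun m => b m - connForm G C A m y) (C y) μ ν ρ
      - wedge (fun m => c m - connForm G A B m y) (B y) μ ν ρ) = 0 := by
    simp only [key, mul_zero, Finset.sum_const_zero]
  simp only [mul_sub, Finset.sum_sub_distrib] at e
  rw [h.contract_wedge_trd hy, h.contract_wedge_snd hy] at e
  simp only [Pi.add_apply, Pi.zero_apply]
  linarith

theorem LocalTriple.connection_unique_fst (h : LocalTriple U G A B C) (hy : y ∈ U)
    {a b c : Fin 4 → ℝ}
    (hA : ∀ μ ν ρ, pd μ (fun z => A z ν ρ) y + pd ν (fun z => A z ρ μ) y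
      + pd ρ (fun z => A z μ ν) y + (wedge b (C y) μ ν ρ - wedge c (B y) μ ν ρ) = 0)
    (hB : ∀ μ ν ρ, pd μ (fun z => B z ν ρ) y + pd ν (fun z => B z ρ μ) y
      + pd ρ (fun z => B z μ ν) y + (wedge c (A y) μ ν ρ - wedge a (C y) μ ν ρ) = 0)
    (hC : ∀ μ ν ρ, pd μ (fun z => C z ν ρ) y + pd ν (fun z => C z ρ μ) y
      + pd ρ (fun z => C z μ ν) y + (wedge a (B y) μ ν ρ - wedge b (A y) μ ν ρ) = 0) :
    a = fun m => connForm G B C m y := by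
  have e1 := h.structure_eq_snd_add_trd hy hA
  have e2 := h.rotate.structure_eq_snd_add_trd hy hB
  have e3 := h.rotate.rotate.structure_eq_snd_add_trd hy hC
  set u := (fun m => a m - connForm G B C m y) with hu
  -- With `u, v, w` the three differences, the cyclic relations say that `uI, vJ, wK` sum to zero in
  -- pairs, so each vanishes.
  have hz : u ᵥ* acs G A y = 0 := by
    funext m
    have f1 := congrFun e1 m
    have f2 := congrFun e2 m
    have f3 := congrFun e3 m
    simp only [Pi.add_apply, Pi.zero_apply] at f1 f2 f3 ⊢
    linarith
  have hz' : u = 0 := by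
    have := congrArg (fun w => w ᵥ* acs G A y) hz
    simpa [Matrix.vecMul_vecMul, (h.quat y hy).II, Matrix.vecMul_neg] using this
  funext m
  have := congrFun hz' m
  simp only [hu, Pi.zero_apply] at this
  linarith

/-! ### Einstein metrics with self-dual Weyl curvature of type D -/

/-- An `SU(2)` structure whose `SU(2)` curvature is that of an Einstein metric of type D. -/
structure TypeDTriple (U : Set R4) (G A B C : R4 → Mat4) (α : R4 → ℝ) (L : ℝ) : Prop
    extends LocalTriple U G A B C where
  smoothα : ContDiffOn ℝ ∞ α U
  ne_zero : ∀ y ∈ U, α y ≠ 0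
  curvA : ∀ y ∈ U, curvContract G A y = (2 * α y + L) • A y
  curvB : ∀ y ∈ U, curvContract G B y = (-α y + L) • B y
  curvC : ∀ y ∈ U, curvContract G C y = (-α y + L) • C y

/-- The vector field `X^μ = A^{μν} ∂_ν f`. -/
noncomputable def hamVec (G A : R4 → Mat4) (f : R4 → ℝ) (y : R4) : Fin 4 → ℝ :=
  raised G A y *ᵥ fun m => pd m f y

namespace LocalTriple

variable (h : LocalTriple U G A B C)
include h

lemma hamVec_vecMul (hy : y ∈ U) (f : R4 → ℝ) (Z : R4 → Mat4) :
    hamVec G A f y ᵥ* Z y = -((fun m => pd m f y) ᵥ* (raised G A y * Z y)) := by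
  rw [hamVec, ← Matrix.vecMul_transpose, h.raised_skew hy (h.skewA y hy), Matrix.vecMul_neg,
    Matrix.neg_vecMul, Matrix.vecMul_vecMul]

lemma smooth_hamVec {f : R4 → ℝ} (hf : ContDiffOn ℝ ∞ f U) (k : Fin 4) :
    ContDiffOn ℝ ∞ (fun z => hamVec G A f z k) U := by
  simp only [hamVec, Matrix.mulVec, dotProduct]
  exact ContDiffOn.sum fun m _ =>
    (((h.smooth_inv.mul h.smoothA).mul h.smooth_inv) k m).mul (contDiffOn_pd h.isOpen hf m)

end LocalTriple

namespace TypeDTriple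

variable (h : TypeDTriple U G A B C α L)
include h

lemma smooth_invCbrt : ContDiffOn ℝ ∞ (fun z => invCbrt (α z)) U :=
  contDiffOn_invCbrt_comp h.smoothα h.ne_zero

/-- In the Bianchi identity for `B`, the eigenvalues of `B` and `C` agree, so one term drops; the
other carries the gap `3α`. The constant `L` disappears on differentiation. -/
lemma pd_α_eq_trd (hy : y ∈ U) (μ : Fin 4) :
    pd μ α y = -3 * α y * ((fun m => connForm G A B m y) ᵥ* acs G C y) μ := by
  have e := h.rotate.pd_curvature_eigenvalue hy (φ := fun z => -α z + L)
    (h.smoothα.neg.add contDiffOn_const) h.curvB (h.curvC y hy) (h.curvA y hy) μ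
  rw [pd_add h.isOpen hy h.smoothα.neg contDiffOn_const, pd_neg, pd_const] at e
  linarith

lemma pd_α_eq_snd (hy : y ∈ U) (μ : Fin 4) :
    pd μ α y = -3 * α y * ((fun m => connForm G C A m y) ᵥ* acs G B y) μ := by
  have e := h.rotate.rotate.pd_curvature_eigenvalue hy (φ := fun z => -α z + L)
    (h.smoothα.neg.add contDiffOn_const) h.curvC (h.curvA y hy) (h.curvB y hy) μ
  rw [pd_add h.isOpen hy h.smoothα.neg contDiffOn_const, pd_neg, pd_const] at e
  linarith

/-- The derivative of the inverse cube root contributes `-f/(3α)`, which exactly cancels the factor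
`-3α` in `pd_α_eq_trd`. -/
lemma pd_f_eq_trd (hy : y ∈ U) :
    (fun m => pd m (fun z => invCbrt (α z)) y)
      = invCbrt (α y) • ((fun m => connForm G A B m y) ᵥ* acs G C y) := by
  funext μ
  have h0 := h.ne_zero y hy
  rw [pd_invCbrt_comp h.isOpen hy h.smoothα h0, h.pd_α_eq_trd hy, Pi.smul_apply, smul_eq_mul]
  field_simp

lemma pd_f_eq_snd (hy : y ∈ U) :
    (fun m => pd m (fun z => invCbrt (α z)) y)
      = invCbrt (α y) • ((fun m => connForm G C A m y) ᵥ* acs G B y) := by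
  funext μ
  have h0 := h.ne_zero y hy
  rw [pd_invCbrt_comp h.isOpen hy h.smoothα h0, h.pd_α_eq_snd hy, Pi.smul_apply, smul_eq_mul]
  field_simp

lemma contract_fst (hy : y ∈ U) :
    hamVec G A (fun z => invCbrt (α z)) y ᵥ* A y = fun m => pd m (fun z => invCbrt (α z)) y := by
  rw [h.hamVec_vecMul hy, (h.raised_mul hy).1, Matrix.vecMul_neg, neg_neg, Matrix.vecMul_one]

/-- `ι_X B = -df·K`; inserting `df = f cK` and `K² = -1` leaves `f c`. The third contraction uses
`df = f bJ` in the same way. -/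
lemma contract_snd (hy : y ∈ U) :
    hamVec G A (fun z => invCbrt (α z)) y ᵥ* B y
      = fun m => invCbrt (α y) * connForm G A B m y := by
  rw [h.hamVec_vecMul hy, (h.raised_mul hy).2.1, h.pd_f_eq_trd hy, Matrix.smul_vecMul,
    Matrix.vecMul_vecMul, (h.quat y hy).KK, Matrix.vecMul_neg, Matrix.vecMul_one, smul_neg, neg_neg]
  rfl

lemma contract_trd (hy : y ∈ U) :
    hamVec G A (fun z => invCbrt (α z)) y ᵥ* C y
      = fun m => -(invCbrt (α y) * connForm G C A m y) := by
  rw [h.hamVec_vecMul hy, (h.raised_mul hy).2.2, Matrix.vecMul_neg, neg_neg, h.pd_f_eq_snd hy,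
    Matrix.smul_vecMul, Matrix.vecMul_vecMul, (h.quat y hy).JJ, Matrix.vecMul_neg,
    Matrix.vecMul_one, smul_neg]
  rfl

/-- The `Σ`-Killing equation, first component. -/
theorem sigmaKilling_fst (hy : y ∈ U) (μ ν : Fin 4) :
    pd μ (fun z => (hamVec G A (fun z => invCbrt (α z)) z ᵥ* A z) ν) y
      - pd ν (fun z => (hamVec G A (fun z => invCbrt (α z)) z ᵥ* A z) μ) y
      + (wedgeOne (fun m => connForm G C A m y)
          (hamVec G A (fun z => invCbrt (α z)) y ᵥ* C y) μ ν
        - wedgeOne (fun m => connForm G A B m y)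
          (hamVec G A (fun z => invCbrt (α z)) y ᵥ* B y) μ ν) = 0 := by
  have e : ∀ k l, pd k (fun z => (hamVec G A (fun z => invCbrt (α z)) z ᵥ* A z) l) y
      = pd k (pd l (fun z => invCbrt (α z))) y := fun k l =>
    pd_congr h.isOpen hy (fun z hz => congrFun (h.contract_fst hz) l) k
  rw [e, e, h.contract_snd hy, h.contract_trd hy, pd_comm h.isOpen hy h.smooth_invCbrt μ ν]
  simp only [wedgeOne]
  ring

/-- The `Σ`-Killing equation, second component. -/
theorem sigmaKilling_snd (hy : y ∈ U) (μ ν : Fin 4) :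
    pd μ (fun z => (hamVec G A (fun z => invCbrt (α z)) z ᵥ* B z) ν) y
      - pd ν (fun z => (hamVec G A (fun z => invCbrt (α z)) z ᵥ* B z) μ) y
      + (wedgeOne (fun m => connForm G A B m y)
          (hamVec G A (fun z => invCbrt (α z)) y ᵥ* A y) μ ν
        - wedgeOne (fun m => connForm G B C m y)
          (hamVec G A (fun z => invCbrt (α z)) y ᵥ* C y) μ ν)
      = -(invCbrt (α y) * (α y - L)) * C y μ ν := by
  have sc := h.smooth_connForm h.smoothA h.smoothB
  have e : ∀ k l, pd k (fun z => (hamVec G A (fun z => invCbrt (α z)) z ᵥ* B z) l) y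
      = pd k (fun z => invCbrt (α z)) y * connForm G A B l y
        + invCbrt (α y) * pd k (connForm G A B l) y := fun k l => by
    rw [← pd_mul h.isOpen hy h.smooth_invCbrt (sc l)]
    exact pd_congr h.isOpen hy (fun z hz => congrFun (h.contract_snd hz) l) k
  have F := congrFun (congrFun ((h.rotate.rotate.curvForm_eq hy).trans (h.curvC y hy)) μ) ν
  simp only [curvForm, Matrix.of_apply, Matrix.smul_apply, smul_eq_mul] at F
  rw [e, e, h.contract_fst hy, h.contract_trd hy]
  simp only [wedgeOne]
  -- The `df ∧ c` terms cancel, and `f` times the curvature `dc + a ∧ b` remains.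
  linear_combination invCbrt (α y) * F

/-- The `Σ`-Killing equation, third component. -/
theorem sigmaKilling_trd (hy : y ∈ U) (μ ν : Fin 4) :
    pd μ (fun z => (hamVec G A (fun z => invCbrt (α z)) z ᵥ* C z) ν) y
      - pd ν (fun z => (hamVec G A (fun z => invCbrt (α z)) z ᵥ* C z) μ) y
      + (wedgeOne (fun m => connForm G B C m y)
          (hamVec G A (fun z => invCbrt (α z)) y ᵥ* B y) μ ν
        - wedgeOne (fun m => connForm G C A m y)
          (hamVec G A (fun z => invCbrt (α z)) y ᵥ* A y) μ ν)
      = (invCbrt (α y) * (α y - L)) * B y μ ν := by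
  have sb := h.smooth_connForm h.smoothC h.smoothA
  have e : ∀ k l, pd k (fun z => (hamVec G A (fun z => invCbrt (α z)) z ᵥ* C z) l) y
      = -(pd k (fun z => invCbrt (α z)) y * connForm G C A l y
        + invCbrt (α y) * pd k (connForm G C A l) y) := fun k l => by
    rw [← pd_mul h.isOpen hy h.smooth_invCbrt (sb l), ← pd_neg]
    exact pd_congr h.isOpen hy (fun z hz => congrFun (h.contract_trd hz) l) k
  have F := congrFun (congrFun ((h.rotate.curvForm_eq hy).trans (h.curvB y hy)) μ) ν
  simp only [curvForm, Matrix.of_apply, Matrix.smul_apply, smul_eq_mul] at F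
  rw [e, e, h.contract_fst hy, h.contract_snd hy]
  simp only [wedgeOne]
  linear_combination -invCbrt (α y) * F

/-- The Killing equation. -/
theorem lieM_hamVec (hy : y ∈ U) :
    lieM (hamVec G A (fun z => invCbrt (α z))) G y = 0 := by
  set X := hamVec G A (fun z => invCbrt (α z)) with hX
  have sX := h.smooth_hamVec h.smooth_invCbrt
  refine h.lieM_metric_eq_zero hy
    -- The Lie derivative rotates the triple with parameter `ι_X A - θ`; only the first component of
    -- `θ` is nonzero.
    (a := ∑ k, X y k * connForm G B C k y - invCbrt (α y) * (α y - L))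
    (b := ∑ k, X y k * connForm G C A k y) (c := ∑ k, X y k * connForm G A B k y) ?_ ?_ ?_
  · ext μ ν
    rw [h.lieM_form hy sX, h.sigmaKilling_fst hy, add_zero]
    rfl
  · ext μ ν
    rw [h.rotate.lieM_form hy sX, h.sigmaKilling_snd hy]
    simp only [Matrix.sub_apply, Matrix.smul_apply, smul_eq_mul]
    ring
  · ext μ ν
    rw [h.rotate.rotate.lieM_form hy sX, h.sigmaKilling_trd hy]
    simp only [Matrix.sub_apply, Matrix.smul_apply, smul_eq_mul]
    ring

end TypeDTriple

end SelfDualGeometry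
namespace SelfDualGeometry

open Matrix

variable {M : Type*} [TopologicalSpace M] [ChartedSpace R4 M]

/-! ### Components of tensor fields in a chart -/

/-- The components of a tangent vector in a chart. -/
noncomputable def tcoord (e : OpenPartialHomeomorph M R4) (y : R4) :
    TangentSpace (𝓡 4) (e.symm y) →ₗ[ℝ] (Fin 4 → ℝ) where
  toFun v := WithLp.ofLp (p := 2) (mfderiv (𝓡 4) (𝓡 4) e (e.symm y) v : R4)
  map_add' v w := by rw [map_add]; rfl
  map_smul' r v := by rw [map_smul]; rfl

lemma vecComp_eq (e : OpenPartialHomeomorph M R4) (X : VField M) (y : R4) :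
    vecComp e X y = tcoord e y (X (e.symm y)) := rfl

variable [IsManifold (𝓡 4) ∞ M] {e : OpenPartialHomeomorph M R4} {y : R4}

lemma mfderiv_chart_coordVec (he : e ∈ atlas R4 M) (hy : y ∈ e.target) (w : R4) :
    mfderiv (𝓡 4) (𝓡 4) e (e.symm y) (mfderiv (𝓡 4) (𝓡 4) e.symm y w) = w := by
  have := (mdifferentiable_of_mem_atlas (I := 𝓡 4) he).comp_symm_deriv hy
  exact DFunLike.congr_fun this w

lemma mfderiv_symm_mfderiv (he : e ∈ atlas R4 M) (hy : y ∈ e.target)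
    (v : TangentSpace (𝓡 4) (e.symm y)) :
    mfderiv (𝓡 4) (𝓡 4) e.symm y (mfderiv (𝓡 4) (𝓡 4) e (e.symm y) v) = v := by
  have := (mdifferentiable_of_mem_atlas (I := 𝓡 4) he).symm_comp_deriv (e.map_target hy)
  rw [e.right_inv hy] at this
  exact DFunLike.congr_fun this v

lemma tcoord_coordVec (he : e ∈ atlas R4 M) (hy : y ∈ e.target) (μ : Fin 4) :
    tcoord e y (coordVec e y μ) = Pi.single μ 1 := by
  change WithLp.ofLp (p := 2) (mfderiv (𝓡 4) (𝓡 4) e (e.symm y)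
    (mfderiv (𝓡 4) (𝓡 4) e.symm y (EuclideanSpace.single μ 1 : R4)) : R4) = _
  rw [mfderiv_chart_coordVec he hy]
  rfl

lemma sum_tcoord (he : e ∈ atlas R4 M) (hy : y ∈ e.target)
    (v : TangentSpace (𝓡 4) (e.symm y)) :
    ∑ μ, tcoord e y v μ • coordVec e y μ = v := by
  have h1 : ∀ (D : R4 →L[ℝ] TangentSpace (𝓡 4) (e.symm y)) (w : R4),
      ∑ μ, w μ • D (EuclideanSpace.single μ 1) = D w := by
    intro D w
    have hw : w = ∑ μ, w μ • (EuclideanSpace.single μ 1 : R4) := by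
      ext i
      simp [Pi.single_apply]
    conv_rhs => rw [hw]
    simp only [map_sum, map_smul]
  exact (h1 (mfderiv (𝓡 4) (𝓡 4) e.symm y) _).trans (mfderiv_symm_mfderiv he hy v)

lemma exists_tcoord (he : e ∈ atlas R4 M) (hy : y ∈ e.target) (w : Fin 4 → ℝ) :
    ∃ v : TangentSpace (𝓡 4) (e.symm y), tcoord e y v = w := by
  refine ⟨∑ μ, w μ • coordVec e y μ, ?_⟩
  simp only [map_sum, map_smul, tcoord_coordVec he hy]
  funext i
  simp [Pi.single_apply]

lemma bilin_apply_coordVec (he : e ∈ atlas R4 M) (hy : y ∈ e.target) (T : BilinField M)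
    (v : TangentSpace (𝓡 4) (e.symm y)) (ν : Fin 4) :
    T (e.symm y) v (coordVec e y ν) = (tcoord e y v ᵥ* bilinComp e T y) ν := by
  conv_lhs => rw [← sum_tcoord he hy v]
  simp only [map_sum, map_smul, Matrix.vecMul, dotProduct, bilinComp, Matrix.of_apply]
  rw [_root_.sum_apply]
  rfl

lemma coordVec_bilin_apply (he : e ∈ atlas R4 M) (hy : y ∈ e.target) (T : BilinField M)
    (v : TangentSpace (𝓡 4) (e.symm y)) (μ : Fin 4) :
    T (e.symm y) (coordVec e y μ) v = (bilinComp e T y *ᵥ tcoord e y v) μ := by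
  conv_lhs => rw [← sum_tcoord he hy v]
  simp only [map_sum, map_smul, Matrix.mulVec, dotProduct, bilinComp, Matrix.of_apply, smul_eq_mul]
  exact Finset.sum_congr rfl fun i _ => mul_comm _ _

lemma tcoord_sharp (he : e ∈ atlas R4 M) (hy : y ∈ e.target) (g : SmoothMetric M)
    (φ : TangentSpace (𝓡 4) (e.symm y) →ₗ[ℝ] ℝ)
    (hd : (bilinComp e g.inner y).det ≠ 0) (hs : (bilinComp e g.inner y)ᵀ = bilinComp e g.inner y) :
    tcoord e y (sharp g (e.symm y) φ)
      = (bilinComp e g.inner y)⁻¹ *ᵥ fun μ => φ (coordVec e y μ) := by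
  have h1 : bilinComp e g.inner y *ᵥ tcoord e y (sharp g (e.symm y) φ)
      = fun μ => φ (coordVec e y μ) := by
    funext μ
    rw [← inner_sharp g, bilin_apply_coordVec he hy, ← Matrix.mulVec_transpose, hs]
  rw [← h1, Matrix.mulVec_mulVec, Matrix.nonsing_inv_mul _ (isUnit_iff_ne_zero.mpr hd),
    Matrix.one_mulVec]

/-! ### Smoothness of components -/

lemma contMDiffOn_chart_symm_atlas (he : e ∈ atlas R4 M) :
    ContMDiffOn (𝓡 4) (𝓡 4) ∞ e.symm e.target :=
  contMDiffOn_symm_of_mem_maximalAtlas (IsManifold.subset_maximalAtlas he)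

lemma contMDiffOn_mfderiv_symm (he : e ∈ atlas R4 M) {V : R4 → R4}
    (hV : ContDiffOn ℝ ∞ V e.target) :
    ContMDiffOn (𝓡 4) (𝓡 4).tangent ∞ (fun y => (⟨e.symm y, mfderiv (𝓡 4) (𝓡 4) e.symm y (V y)⟩ :
      TangentBundle (𝓡 4) M)) e.target := by
  have h1 := (contMDiffOn_chart_symm_atlas he).contMDiffOn_tangentMapWithin (m := ∞) (by simp)
    e.open_target.uniqueMDiffOn
  have h2 : ContMDiffOn (𝓡 4) (𝓡 4).tangent ∞
      (fun y : R4 => (⟨y, V y⟩ : TangentBundle (𝓡 4) R4)) e.target :=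
    contMDiffOn_vectorSpace_iff_contDiffOn.mpr hV
  refine (h1.comp h2 fun y hy => hy).congr fun y hy => ?_
  simp only [Function.comp, tangentMapWithin, mfderivWithin_of_isOpen e.open_target hy]

lemma contMDiffOn_coordVec (he : e ∈ atlas R4 M) (μ : Fin 4) :
    ContMDiffOn (𝓡 4) (𝓡 4).tangent ∞ (fun y => (⟨e.symm y, coordVec e y μ⟩ :
      TangentBundle (𝓡 4) M)) e.target :=
  contMDiffOn_mfderiv_symm he contDiffOn_const

lemma smooth_bilinComp (he : e ∈ atlas R4 M) {T : BilinField M}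
    (hT : ContMDiff (𝓡 4) ((𝓡 4).prod 𝓘(ℝ, R4 →L[ℝ] R4 →L[ℝ] ℝ)) ∞
      (fun x : M => TotalSpace.mk' (R4 →L[ℝ] R4 →L[ℝ] ℝ)
        (E := fun x : M => TangentSpace (𝓡 4) x →L[ℝ] TangentSpace (𝓡 4) x →L[ℝ] ℝ) x (T x))) :
    MSmooth e.target (bilinComp e T) := by
  intro μ ν
  have hs := contMDiffOn_chart_symm_atlas he
  have h : ContMDiffOn (𝓡 4) ((𝓡 4).prod 𝓘(ℝ)) ∞
      (fun y => TotalSpace.mk' ℝ (E := Bundle.Trivial M ℝ) (e.symm y)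
        (T (e.symm y) (coordVec e y μ) (coordVec e y ν))) e.target := by
    apply ContMDiffOn.clm_bundle_apply₂ (F₁ := R4) (F₂ := R4)
    · exact hT.comp_contMDiffOn hs
    · exact contMDiffOn_coordVec he μ
    · exact contMDiffOn_coordVec he ν
  intro y hy
  have h2 := h y hy
  simp only [contMDiffWithinAt_totalSpace] at h2
  exact h2.2.contDiffWithinAt

lemma isLocalMetric (he : e ∈ atlas R4 M) (g : SmoothMetric M) :
    LocalMetric e.target (bilinComp e g.inner) where
  isOpen := e.open_target
  smooth := smooth_bilinComp he g.contMDiff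
  symm y _ := by
    ext i j
    exact g.symm _ _ _
  det_ne y hy h0 := by
    -- A kernel vector of the component matrix would be orthogonal to every vector, itself included,
    -- against positivity.
    obtain ⟨w, hw, h⟩ := Matrix.exists_mulVec_eq_zero_iff.mpr h0
    obtain ⟨v, rfl⟩ := exists_tcoord he hy w
    have hv : v ≠ 0 := fun h => hw (by rw [h, map_zero])
    have key : ∀ u, g.inner (e.symm y) u v = 0 := fun u => by
      rw [← sum_tcoord he hy u, map_sum, _root_.sum_apply]
      refine Finset.sum_eq_zero fun μ _ => ?_
      rw [map_smul, _root_.smul_apply, coordVec_bilin_apply he hy, h]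
      simp
    exact (g.pos _ v hv).ne' (key v)
  pos y hy := g.pos _ _ fun h => by
    have := tcoord_coordVec he hy 0
    rw [h, map_zero] at this
    simpa using congrFun this 0

end SelfDualGeometry
namespace SelfDualGeometry

open Matrix

/-! ### The smoothness of the curvature -/

section

variable {U : Set R4} {G A B : R4 → Mat4}

lemma LocalMetric.smooth_curvM (h : LocalMetric U G) (m n : Fin 4) :
    MSmooth U (curvM G m n) :=
  (((h.smooth_gam n).pdM h.isOpen m).sub ((h.smooth_gam m).pdM h.isOpen n)).add
    (((h.smooth_gam m).mul (h.smooth_gam n)).sub ((h.smooth_gam n).mul (h.smooth_gam m)))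

lemma LocalMetric.smooth_curvContract (h : LocalMetric U G) (hA : MSmooth U A) :
    MSmooth U (curvContract G A) := fun m n =>
  contDiffOn_const.mul ((h.smooth_curvM m n).mul (h.smooth_acs hA)).trace

end

lemma bilinComp_skew {M : Type*} [TopologicalSpace M] [ChartedSpace R4 M]
    {e : OpenPartialHomeomorph M R4} {B : BilinField M} (hB : ∀ x v, B x v v = 0) (y : R4) :
    (bilinComp e B y)ᵀ = -bilinComp e B y := by
  ext i j
  have h := hB (e.symm y) (coordVec e y i + coordVec e y j)
  simp only [map_add, _root_.add_apply, hB] at h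
  simp only [Matrix.transpose_apply, Matrix.neg_apply, bilinComp, Matrix.of_apply]
  linarith

variable {M : Type*} [TopologicalSpace M] [ChartedSpace R4 M] [IsManifold (𝓡 4) ∞ M]
  {e : OpenPartialHomeomorph M R4} {y : R4} {g : SmoothMetric M} {S : Fin 3 → BilinField M}
  {Λ : ℝ} {α : M → ℝ}

/-! ### The structure equations in a chart -/

/-- The minus sign arises because `endo` inserts the vector in the first slot of the form, whereas
`acs` acts through the second. -/
lemma tcoord_endo (he : e ∈ atlas R4 M) (hy : y ∈ e.target) {B : BilinField M}
    (hB : (bilinComp e B y)ᵀ = -bilinComp e B y) (v : TangentSpace (𝓡 4) (e.symm y)) :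
    tcoord e y (endo g B (e.symm y) v)
      = -(acs (bilinComp e g.inner) (bilinComp e B) y *ᵥ tcoord e y v) := by
  have hG := isLocalMetric he g
  rw [endo, tcoord_sharp he hy g _ (hG.det_ne y hy) (hG.symm y hy)]
  have h1 : (fun μ => (B (e.symm y) v).toLinearMap (coordVec e y μ))
      = tcoord e y v ᵥ* bilinComp e B y := by
    funext μ
    exact bilin_apply_coordVec he hy B v μ
  rw [h1, ← Matrix.mulVec_transpose, hB, Matrix.neg_mulVec, Matrix.mulVec_neg, Matrix.mulVec_mulVec,
    acs]

/-- Both sides of the quaternion relation change under `endo = -acs`: the product is even and keeps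
its sign, the linear term flips. With the factors in this order the table becomes `IJ = K`. -/
lemma acs_mul_acs (hS : IsSU2Structure g S) (he : e ∈ atlas R4 M) (hy : y ∈ e.target)
    (i j : Fin 3) :
    acs (bilinComp e g.inner) (bilinComp e (S j)) y * acs (bilinComp e g.inner) (bilinComp e (S i)) y
      = -((if i = j then (1 : ℝ) else 0) • (1 : Mat4))
        - ∑ k, eps i j k • acs (bilinComp e g.inner) (bilinComp e (S k)) y := by
  have hs := fun k => bilinComp_skew (e := e) (hS.alternating k) y
  refine Matrix.toLin'.injective (LinearMap.ext fun w => ?_)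
  obtain ⟨v, rfl⟩ := exists_tcoord he hy w
  have h := congrArg (tcoord e y) (hS.quaternion i j (e.symm y) v)
  rw [tcoord_endo he hy (hs j), tcoord_endo he hy (hs i), Matrix.mulVec_neg, neg_neg,
    Matrix.mulVec_mulVec] at h
  simp only [map_add, map_neg, map_smul, map_sum, tcoord_endo he hy (hs _)] at h
  simp only [Matrix.toLin'_apply]
  rw [h]
  simp only [Matrix.add_mulVec, Matrix.neg_mulVec, Matrix.smul_mulVec, Matrix.one_mulVec,
    Matrix.sum_mulVec, smul_neg, Finset.sum_neg_distrib, sub_eq_add_neg]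

lemma isLocalTriple (hS : IsSU2Structure g S) (he : e ∈ atlas R4 M) :
    LocalTriple e.target (bilinComp e g.inner) (bilinComp e (S 0)) (bilinComp e (S 1))
      (bilinComp e (S 2)) :=
  { isLocalMetric he g with
    smoothA := smooth_bilinComp he (hS.smooth 0)
    smoothB := smooth_bilinComp he (hS.smooth 1)
    smoothC := smooth_bilinComp he (hS.smooth 2)
    skewA := fun y _ => bilinComp_skew (hS.alternating 0) y
    skewB := fun y _ => bilinComp_skew (hS.alternating 1) y
    skewC := fun y _ => bilinComp_skew (hS.alternating 2) y
    quat := fun y hy => by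
      have h := acs_mul_acs hS he hy
      constructor <;> rw [h] <;> simp [Fin.sum_univ_three, eps] <;> norm_num }

/-- The eigenvalue of the self-dual Weyl curvature in a chart is smooth. -/
lemma smooth_α (hS : IsSU2Structure g S) (hE : IsEinstein g Λ) (hD : IsTypeDFrame g S α)
    (he : e ∈ atlas R4 M) : ContDiffOn ℝ ∞ (fun y => α (e.symm y)) e.target := by
  have hG := isLocalMetric he g
  have hT := isLocalTriple hS he
  have h1 : ContDiffOn ℝ ∞ (fun y => -(-(1 / 4)
      * ((bilinComp e g.inner y)⁻¹ * curvContract (bilinComp e g.inner) (bilinComp e (S 1)) y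
        * acs (bilinComp e g.inner) (bilinComp e (S 1)) y).trace
      + Λ / 12 * (acs (bilinComp e g.inner) (bilinComp e (S 1)) y
        * acs (bilinComp e g.inner) (bilinComp e (S 1)) y).trace)) e.target := by
    have s := hG.smooth_acs hT.smoothB
    exact ((contDiffOn_const.mul
      ((hG.smooth_inv.mul (hG.smooth_curvContract hT.smoothB)).mul s).trace).add
      (contDiffOn_const.mul (s.mul s).trace)).neg
  refine h1.congr fun y hy => ?_
  -- No regularity of `α` is assumed; this diagonal entry exhibits `-α` as a smooth expression in
  -- the curvature.
  have d := congrFun (congrFun (hD.2 e he y hy) 1) 1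
  rw [← hG.weyl_contract hy (hE e he y hy) (hT.skewB y hy)]
  simp only [selfDualWeylMatrix, Matrix.of_apply, Matrix.diagonal_apply_eq] at d
  rw [d]
  simp

lemma isTypeDTriple (hS : IsSU2Structure g S) (hE : IsEinstein g Λ) (hD : IsTypeDFrame g S α)
    (he : e ∈ atlas R4 M) :
    TypeDTriple e.target (bilinComp e g.inner) (bilinComp e (S 0)) (bilinComp e (S 1))
      (bilinComp e (S 2)) (fun y => α (e.symm y)) (Λ / 3) := by
  have hT := isLocalTriple hS he
  have d : ∀ y ∈ e.target, ∀ i j, (1 / 8) * ∑ m, ∑ n, ∑ r, ∑ s, weyl (bilinComp e g.inner) m n r s y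
      * raised (bilinComp e g.inner) (bilinComp e (S i)) y m n
      * raised (bilinComp e g.inner) (bilinComp e (S j)) y r s
      = Matrix.diagonal ![2 * α (e.symm y), -α (e.symm y), -α (e.symm y)] i j :=
    fun y hy i j => congrFun (congrFun (hD.2 e he y hy) i) j
  refine { hT with
    smoothα := smooth_α hS hE hD he
    ne_zero := fun y _ => hD.1 _
    curvA := fun y hy => ?_
    curvB := fun y hy => ?_
    curvC := fun y hy => ?_ }
  · rw [hT.curvContract_eq_weyl hy (hE e he y hy), d y hy, d y hy, d y hy]
    simp [Matrix.diagonal]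
  · rw [hT.rotate.curvContract_eq_weyl hy (hE e he y hy), d y hy, d y hy, d y hy]
    simp [Matrix.diagonal]
  · rw [hT.rotate.rotate.curvContract_eq_weyl hy (hE e he y hy), d y hy, d y hy, d y hy]
    simp [Matrix.diagonal]

/-! ### The vector field in a chart -/

lemma mdifferentiableAt_of_chart {f : M → ℝ} (he : e ∈ atlas R4 M)
    (hf : ContDiffOn ℝ ∞ (fun z => f (e.symm z)) e.target) (hy : y ∈ e.target) :
    MDifferentiableAt (𝓡 4) 𝓘(ℝ, ℝ) f (e.symm y) := by
  have hx := e.map_target hy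
  have h1 : MDifferentiableAt (𝓡 4) (𝓡 4) e (e.symm y) :=
    (mdifferentiable_of_mem_atlas (I := 𝓡 4) he).mdifferentiableAt hx
  have h2 : MDifferentiableAt (𝓡 4) 𝓘(ℝ, ℝ) (fun z => f (e.symm z)) (e (e.symm y)) := by
    rw [e.right_inv hy]
    exact (hf.differentiableAt_of_open e.open_target hy).mdifferentiableAt
  refine (h2.comp (e.symm y) h1).congr_of_eventuallyEq ?_
  filter_upwards [e.open_source.mem_nhds hx] with x hx
  simp only [Function.comp, e.left_inv hx]

lemma formComp_differential {f : M → ℝ} (he : e ∈ atlas R4 M)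
    (hf : ContDiffOn ℝ ∞ (fun z => f (e.symm z)) e.target) (hy : y ∈ e.target) (μ : Fin 4) :
    differential f (e.symm y) (coordVec e y μ) = pd μ (fun z => f (e.symm z)) y := by
  have h1 := mdifferentiableAt_of_chart he hf hy
  have h2 := mdifferentiableAt_atlas_symm (I := 𝓡 4) he hy
  have h3 := mfderiv_comp y h1 h2
  rw [mfderiv_eq_fderiv] at h3
  exact (DFunLike.congr_fun h3 (EuclideanSpace.single μ 1 : R4)).symm

lemma vecComp_hamiltonianField (he : e ∈ atlas R4 M) {B : BilinField M} {f : M → ℝ}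
    (hf : ContDiffOn ℝ ∞ (fun z => f (e.symm z)) e.target) (hy : y ∈ e.target) :
    vecComp e (hamiltonianField g B f) y
      = hamVec (bilinComp e g.inner) (bilinComp e B) (fun z => f (e.symm z)) y := by
  have hG := isLocalMetric he g
  rw [vecComp_eq, hamiltonianField, tcoord_sharp he hy g _ (hG.det_ne y hy) (hG.symm y hy)]
  have h1 : ∀ μ, B (e.symm y) (coordVec e y μ)
      (sharp g (e.symm y) (differential f (e.symm y)).toLinearMap)
      = (bilinComp e B y *ᵥ ((bilinComp e g.inner y)⁻¹ *ᵥ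
          fun m => pd m (fun z => f (e.symm z)) y)) μ := by
    intro μ
    rw [coordVec_bilin_apply he hy, tcoord_sharp he hy g _ (hG.det_ne y hy) (hG.symm y hy)]
    simp only [ContinuousLinearMap.coe_coe, formComp_differential he hf hy]
  simp only [LinearMap.coe_mk, AddHom.coe_mk, h1]
  rw [hamVec, raised, ← Matrix.mulVec_mulVec, ← Matrix.mulVec_mulVec]

/-- Near each point the field is the image of its component vector under the tangent map of the
inverse chart. -/
lemma contMDiff_of_vecComp {X : VField M}
    (hX : ∀ e ∈ atlas R4 M, ∀ k, ContDiffOn ℝ ∞ (fun y => vecComp e X y k) e.target) :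
    ContMDiff (𝓡 4) (𝓡 4).tangent ∞ (fun x : M => (⟨x, X x⟩ : TangentBundle (𝓡 4) M)) := by
  intro x
  have he := chart_mem_atlas R4 x
  set e := chartAt R4 x
  have hx : x ∈ e.source := mem_chart_source R4 x
  have hV : ContDiffOn ℝ ∞ (fun y => (WithLp.toLp 2 (vecComp e X y) : R4)) e.target := by
    rw [contDiffOn_euclidean]
    exact hX e he
  have h1 := (contMDiffOn_mfderiv_symm he hV).comp
    (contMDiffOn_of_mem_maximalAtlas (IsManifold.subset_maximalAtlas he)) fun z hz => e.map_source hz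
  refine ((h1.congr fun z hz => ?_) x hx).contMDiffAt (e.open_source.mem_nhds hx)
  have hz' := e.map_source hz
  have h2 := mfderiv_symm_mfderiv he hz' (X (e.symm (e z)))
  have h3 : (⟨z, X z⟩ : TangentBundle (𝓡 4) M) = ⟨e.symm (e z), X (e.symm (e z))⟩ := by
    rw [e.left_inv hz]
  refine h3.trans ?_
  exact congrArg (fun v => (⟨e.symm (e z), v⟩ : TangentBundle (𝓡 4) M)) h2.symm

lemma formComp_contractWith (he : e ∈ atlas R4 M) (hy : y ∈ e.target) (X : VField M)
    (B : BilinField M) : formComp e (contractWith X B) y = vecComp e X y ᵥ* bilinComp e B y := by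
  funext μ
  exact bilin_apply_coordVec he hy B (X (e.symm y)) μ

end SelfDualGeometry

/-! ### The theorem on the manifold, chart by chart -/

open SelfDualGeometry
theorem mainTheorem2 {M : Type*} [TopologicalSpace M] [ChartedSpace R4 M]
    [IsManifold (𝓡 4) ∞ M] (g : SmoothMetric M) (S : Fin 3 → BilinField M) (Λ : ℝ) (α : M → ℝ)
    (hS : IsSU2Structure g S) (hE : IsEinstein g Λ) (hD : IsTypeDFrame g S α) :
    IsKilling g (hamiltonianField g (S 0) (fun x => invCbrt (α x))) ∧
    ∀ A : Fin 3 → OneForm M, IsCompatibleConnection S A →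
      SatisfiesSigmaKilling S A (hamiltonianField g (S 0) (fun x => invCbrt (α x)))
        ![fun x => invCbrt (α x) * (α x - Λ / 3), fun _ => 0, fun _ => 0] := by
  have hf : ∀ e ∈ atlas R4 M, ContDiffOn ℝ ∞ (fun z => invCbrt (α (e.symm z))) e.target :=
    fun e he => (isTypeDTriple hS hE hD he).smooth_invCbrt
  have hX : ∀ e ∈ atlas R4 M, ∀ y ∈ e.target,
      vecComp e (hamiltonianField g (S 0) (fun x => invCbrt (α x))) y
        = hamVec (bilinComp e g.inner) (bilinComp e (S 0)) (fun z => invCbrt (α (e.symm z))) y :=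
    fun e he y hy => vecComp_hamiltonianField (f := fun x => invCbrt (α x)) he (hf e he) hy
  refine ⟨⟨contMDiff_of_vecComp fun e he k => ?_, fun e he y hy μ ν => ?_⟩,
    fun A hA e he y hy i μ ν => ?_⟩
  · exact ((isLocalTriple hS he).smooth_hamVec (hf e he) k).congr fun y hy =>
      congrFun (hX e he y hy) k
  · have hT := isTypeDTriple hS hE hD he
    have h1 : ∀ k m, pd m (fun z => vecComp e
        (hamiltonianField g (S 0) (fun x => invCbrt (α x))) z k) y
        = pd m (fun z => hamVec (bilinComp e g.inner) (bilinComp e (S 0))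
          (fun z => invCbrt (α (e.symm z))) z k) y := fun k m =>
      pd_congr e.open_target hy (fun z hz => congrFun (hX e he z hz) k) m
    have h2 := lieDerivMetric_eq (hamVec (bilinComp e g.inner) (bilinComp e (S 0))
      (fun z => invCbrt (α (e.symm z)))) (bilinComp e g.inner) y μ ν
    rw [hT.lieM_hamVec hy] at h2
    simp only [lieDerivMetric, h1, hX e he y hy] at h2 ⊢
    exact h2
  · have hT := isTypeDTriple hS hE hD he
    have h1 : ∀ k m n, pd m (fun z => formComp e (contractWith
        (hamiltonianField g (S 0) (fun x => invCbrt (α x))) (S k)) z n) y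
        = pd m (fun z => Matrix.vecMul (hamVec (bilinComp e g.inner) (bilinComp e (S 0))
          (fun z => invCbrt (α (e.symm z))) z) (bilinComp e (S k) z) n) y := fun k m n =>
      pd_congr e.open_target hy (fun z hz => by
        rw [formComp_contractWith he hz, hX e he z hz]) m
    have hc := hA e he y hy
    have c0 : ∀ μ ν ρ, pd μ (fun z => bilinComp e (S 0) z ν ρ) y
        + pd ν (fun z => bilinComp e (S 0) z ρ μ) y + pd ρ (fun z => bilinComp e (S 0) z μ ν) y
        + (wedge (formComp e (A 1) y) (bilinComp e (S 2) y) μ ν ρ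
          - wedge (formComp e (A 2) y) (bilinComp e (S 1) y) μ ν ρ) = 0 := fun μ ν ρ => by
      have := hc 0 μ ν ρ
      norm_num [covExtDerivTwo, Fin.sum_univ_three, eps] at this
      simp only [wedge]
      linarith
    have c1 : ∀ μ ν ρ, pd μ (fun z => bilinComp e (S 1) z ν ρ) y
        + pd ν (fun z => bilinComp e (S 1) z ρ μ) y + pd ρ (fun z => bilinComp e (S 1) z μ ν) y
        + (wedge (formComp e (A 2) y) (bilinComp e (S 0) y) μ ν ρ
          - wedge (formComp e (A 0) y) (bilinComp e (S 2) y) μ ν ρ) = 0 := fun μ ν ρ => by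
      have := hc 1 μ ν ρ
      norm_num [covExtDerivTwo, Fin.sum_univ_three, eps] at this
      simp only [wedge]
      linarith
    have c2 : ∀ μ ν ρ, pd μ (fun z => bilinComp e (S 2) z ν ρ) y
        + pd ν (fun z => bilinComp e (S 2) z ρ μ) y + pd ρ (fun z => bilinComp e (S 2) z μ ν) y
        + (wedge (formComp e (A 0) y) (bilinComp e (S 1) y) μ ν ρ
          - wedge (formComp e (A 1) y) (bilinComp e (S 0) y) μ ν ρ) = 0 := fun μ ν ρ => by
      have := hc 2 μ ν ρ
      norm_num [covExtDerivTwo, Fin.sum_univ_three, eps] at this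
      simp only [wedge]
      linarith
    -- Uniqueness identifies the given connection with the Levi-Civita one, for which the three
    -- `Σ`-Killing components are known.
    have a0 := hT.connection_unique_fst hy c0 c1 c2
    have a1 := hT.rotate.connection_unique_fst hy c1 c2 c0
    have a2 := hT.rotate.rotate.connection_unique_fst hy c2 c0 c1
    have s0 := hT.sigmaKilling_fst hy μ ν
    have s1 := hT.sigmaKilling_snd hy μ ν
    have s2 := hT.sigmaKilling_trd hy μ ν
    rw [← a1, ← a2] at s0
    rw [← a2, ← a0] at s1
    rw [← a0, ← a1] at s2
    simp only [covExtDerivOne, h1, formComp_contractWith he hy, hX e he y hy]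
    simp only [wedgeOne] at s0 s1 s2
    generalize hθ : (![fun x => invCbrt (α x) * (α x - Λ / 3), fun _ => 0, fun _ => 0] :
      Fin 3 → M → ℝ) = θ
    have t0 : θ 0 (e.symm y) = invCbrt (α (e.symm y)) * (α (e.symm y) - Λ / 3) := by
      rw [← hθ]; rfl
    have t1 : θ 1 (e.symm y) = 0 := by rw [← hθ]; rfl
    have t2 : θ 2 (e.symm y) = 0 := by rw [← hθ]; rfl
    obtain rfl | rfl | rfl : i = 0 ∨ i = 1 ∨ i = 2 := by fin_cases i <;> simp
    all_goals
      norm_num [Fin.sum_univ_three, eps, t0, t1, t2]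
      linarith
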